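/- Let $G$ be a locally compact (Hausdorff) group with left Haar measure $dt$ and modular function $\Delta$ (so that $\int_G f(ts)\,dt=\Delta(s)^{-1}\int_G f(t)\,dt$). Equip $L^1(G)$ with the product $(f*g)(t)=\int_G f(s)g(s^{-1}t)\,ds$, the involution $f^*(t)=\Delta(t^{-1})\overline{f(t^{-1})}$ and the $L^1$-norm, and regard $C_c(G)$ (continuous complex functions with compact support) as a $*$-subalgebra. Let $\mathfrak T$ be the locally convex inductive limit topology on $C_c(G)=\bigcup_K C_K(G)$, where $K$ runs over the compact subsets of $G$ and the space $C_K(G)$ of functions supported in $K$ carries the $L^1$-norm; that is, $\mathfrak T$ is the finest locally convex vector space topology making all inclusions $C_K(G)\to C_c(G)$ continuous. Let $\varepsilon_G(f)=\int_G f(t)\,dt$. Let $\tilde C_c(G)=C_c(G)\oplus\mathbb C$ be the unitalization, with the direct sum topology $\tilde{\mathfrak T}$, and put $$C_c^0(G)=\{f\in C_c(G):\textstyle\int_G f(t)\,dt=0\},\qquad \tilde C_c^0(G)=\{(f,\lambda)\in\tilde C_c(G):\lambda=-\textstyle\int_G f(t)\,dt\},$$ with the subspace topologies. Let $A$ be a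 complex $*$-algebra with a locally convex topology $\tau$, and let $\varepsilon$ be a continuous $*$-character of $A$. Continuity of a $*$-representation $\Phi:A\to\mathcal L(\mathfrak H)$ on a Hilbert space refers to the operator norm. * $(A_\tau,\varepsilon)$ has property $(FH)$ if for every continuous $*$-representation $\Phi:A\to\mathcal L(\mathfrak H)$ on a Hilbert space and every continuous linear $\theta:A\to\mathfrak H$ with $\theta(ab)=\Phi(a)\theta(b)+\varepsilon(b)\theta(a)$ for all $a,b\in A$, there is $\xi\in\mathfrak H$ with $\theta(a)=\varepsilon(a)\xi-\Phi(a)\xi$ for all $a\in A$. * $A_\tau$ has property $(CH)$ if for every continuous $*$-representation $\Phi:A\to\mathcal L(\mathfrak H)$ on a Hilbert space and every continuous linear $\Lambda:A\to\mathfrak H$ with $\Lambda(ab)=\Phi(a)\Lambda(b)$ for all $a,b\in A$, there is $\xi\in\mathfrak H$ with $\Lambda(a)=\Phi(a)\xi$ for all $a\in A$. A unitary representation $\pi$ of $G$ on a Hilbert space $\mathfrak H$ is called continuous if $t\mapsto\pi(t)x$ is norm-continuous for each $x\in\mathfrak H$. For such $\pi$ put $\hat\pi(f,\lambda)x=\lambda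 x+\int_G f(t)\pi(t)x\,dt$ for $(f,\lambda)\in\tilde C_c(G)$ and $x\in\mathfrak H$. The group $G$ has property $(T)$ if every continuous unitary representation of $G$ having almost invariant unit vectors (for every compact $K\subseteq G$ and $\delta>0$ there is a unit vector $\xi$ with $\|\pi(t)\xi-\xi\|<\delta$ for all $t\in K$) has a non-zero invariant vector. **Theorem.** Let $G$ be a locally compact group. (a) $(L^1(G),\varepsilon_G)$, with the norm topology, has property $(FH)$. (b) If $G$ is second countable, the following are equivalent: 1. $G$ has property $(T)$; 2. $(C_c(G)_{\mathfrak T},\varepsilon_G)$ has property $(FH)$; 3. $\tilde C_c^0(G)_{\tilde{\mathfrak T}}$ has property $(CH)$; 4. for every continuous unitary representation $\pi$ of $G$ on a Hilbert space $\mathfrak H$ and every $\tilde{\mathfrak T}$-continuous linear map $\Xi:\tilde C_c^0(G)\to\mathfrak H$ with $\Xi(ab)=\hat\pi(a)\Xi(b)$ for all $a,b\in\tilde C_c^0(G)$, there is $\xi_0\in\mathfrak H$ with $\Xi(a)=\hat\pi(a)\xi_0$ for all $a\in\tilde C_c^0(G)$. (c) If $G$ is second countable and $C_c^0(G)_{\mathfrak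 T}$ has property $(CH)$, then $G$ has property $(T)$. -/

import Mathlib

universe u v

namespace GroupAlg

open MeasureTheory MeasureTheory.Measure Filter Topology
open scoped ENNReal NNReal Pointwise

noncomputable section

set_option linter.unusedSectionVars false

section Haar

variable {G : Type*} [Group G] [TopologicalSpace G] [IsTopologicalGroup G]
  [LocallyCompactSpace G] [MeasurableSpace G] [BorelSpace G]

/-- The modular function `Δ`, normalised by `μ (E t) = Δ t * μ E` for a left Haar measure `μ`.
Mathlib's `modularCharacter` is normalised by `μ (E t⁻¹) = modularCharacter t * μ E`. -/
def modularFn (t : G) : ℝ := ((modularCharacter t : ℝ≥0) : ℝ)⁻¹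

lemma modularFn_pos (t : G) : 0 < modularFn t :=
  inv_pos.2 (NNReal.coe_pos.2 (modularCharacterFun_pos t))

lemma modularFn_mul (s t : G) : modularFn (s * t) = modularFn s * modularFn t := by
  simp [modularFn, mul_comm]

lemma modularFn_one : modularFn (1 : G) = 1 := by simp [modularFn]

lemma modularFn_inv_mul_self (t : G) : modularFn t⁻¹ * modularFn t = 1 := by
  rw [← modularFn_mul, inv_mul_cancel, modularFn_one]

lemma inv_measurableEmbedding : MeasurableEmbedding (Inv.inv : G → G) :=
  (Homeomorph.inv G).measurableEmbedding

variable (μ : Measure G) [μ.IsHaarMeasure] [μ.Regular]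

lemma map_mul_right (g : G) : map (· * g) μ = (modularCharacter g : ℝ≥0) • μ := by
  have : (map (· * g) μ).Regular := Regular.map (Homeomorph.mulRight g)
  have h := isMulLeftInvariant_eq_smul_of_regular (map (· * g) μ) μ
  rw [h]; congr 1
  exact (modularCharacterFun_eq_haarScalarFactor μ g).symm

lemma measure_mul_right (g : G) (E : Set G) :
    μ ((· * g) ⁻¹' E) = (modularCharacter g : ℝ≥0) • μ E := by
  have := congrArg (fun ν : Measure G => ν E) (map_mul_right μ g)
  simp only [Measure.smul_apply] at this
  rw [← this]
  exact ((Homeomorph.mulRight g).measurableEmbedding.map_apply μ E).symm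

lemma continuous_modularFn : Continuous (modularFn : G → ℝ) := by
  obtain ⟨f, f_comp, f_nonneg, f_one⟩ :
    ∃ f : C(G, ℝ), HasCompactSupport f ∧ 0 ≤ f ∧ f 1 ≠ 0 := exists_continuous_nonneg_pos 1
  have hpos : 0 < ∫ x, f x ∂(haar : Measure G) :=
    f.continuous.integral_pos_of_hasCompactSupport_nonneg_nonzero f_comp f_nonneg f_one
  have h1 : ∀ g : G, ∫ y, f (y⁻¹ * g) ∂(haar : Measure G).inv
      = ((modularCharacter g : ℝ≥0) : ℝ) * ∫ x, f x ∂(haar : Measure G) := by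
    intro g
    have e1 : ∫ y, f (y⁻¹ * g) ∂(haar : Measure G).inv = ∫ y, f (y * g) ∂(haar : Measure G) := by
      rw [Measure.inv, inv_measurableEmbedding.integral_map]
      simp
    have e2 : ∫ y, f (y * g) ∂(haar : Measure G) = ∫ y, f y ∂(map (· * g) (haar : Measure G)) :=
      ((Homeomorph.mulRight g).measurableEmbedding.integral_map (μ := haar) f).symm
    rw [e1, e2, map_mul_right, integral_smul_nnreal_measure]
    rfl
  have h2 := continuous_integral_apply_inv_mul (μ := (haar : Measure G).inv) f.continuous f_comp
  have h3 : Continuous fun g : G => ((modularCharacter g : ℝ≥0) : ℝ) := by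
    have : (fun g : G => ((modularCharacter g : ℝ≥0) : ℝ))
        = fun g => (∫ y, f (y⁻¹ * g) ∂(haar : Measure G).inv) / ∫ x, f x ∂(haar : Measure G) := by
      funext g; rw [h1 g]; field_simp
    rw [this]; exact h2.div_const _
  exact h3.inv₀ fun g => (NNReal.coe_pos.2 (modularCharacterFun_pos g)).ne'

/-- The measure `Δ(t⁻¹) dt⁻¹`; it is shown to be dominated by `μ`. -/
def flipMeasure : Measure G := μ.inv.withDensity fun t => ENNReal.ofReal (modularFn t)

lemma inv_ac_flip : μ.inv ≪ flipMeasure μ :=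
  withDensity_absolutelyContinuous' (by
    exact (ENNReal.measurable_ofReal.comp continuous_modularFn.measurable).aemeasurable)
    (Eventually.of_forall fun t => by simpa using modularFn_pos t)

lemma measurable_density : Measurable fun t : G => ENNReal.ofReal (modularFn t) :=
  ENNReal.measurable_ofReal.comp continuous_modularFn.measurable

lemma inv_map_mul_left (g : G) :
    map (g * ·) μ.inv = (modularCharacter g : ℝ≥0)⁻¹ • μ.inv := by
  ext E hE
  rw [map_apply (measurable_const_mul g) hE, Measure.smul_apply, Measure.inv_apply,
    Measure.inv_apply]
  have : ((g * ·) ⁻¹' E)⁻¹ = (· * g⁻¹) ⁻¹' E⁻¹ := by ext x; simp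
  rw [this, measure_mul_right, map_inv]

instance : (flipMeasure μ).IsMulLeftInvariant := by
  refine ⟨fun g => ?_⟩
  ext E hE
  rw [map_apply (measurable_const_mul g) hE]
  unfold flipMeasure
  rw [withDensity_apply _ hE, withDensity_apply _ (measurable_const_mul g hE)]
  have h := inv_map_mul_left μ g
  have h2 : ∫⁻ t in E, ENNReal.ofReal (modularFn t) ∂(map (g * ·) μ.inv)
      = ∫⁻ t in (g * ·) ⁻¹' E, ENNReal.ofReal (modularFn (g * t)) ∂μ.inv :=
    setLIntegral_map hE measurable_density (measurable_const_mul g)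
  rw [h] at h2
  simp only [modularFn_mul, ENNReal.ofReal_mul (modularFn_pos g).le] at h2
  rw [lintegral_const_mul _ measurable_density] at h2
  rw [Measure.restrict_smul, lintegral_smul_measure] at h2
  have h3 : ENNReal.ofReal (modularFn g) = (((modularCharacter g : ℝ≥0)⁻¹ : ℝ≥0) : ℝ≥0∞) := by
    rw [modularFn, ← NNReal.coe_inv, ENNReal.ofReal_coe_nnreal]
  rw [h3, ENNReal.smul_def, smul_eq_mul] at h2
  refine (ENNReal.mul_right_inj ?_ ENNReal.coe_ne_top).1 h2.symm
  exact ENNReal.coe_ne_zero.2 (inv_ne_zero (modularCharacterFun_pos g).ne')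

instance : IsFiniteMeasureOnCompacts (flipMeasure μ) := by
  refine ⟨fun K hK => ?_⟩
  obtain ⟨C, hC⟩ := (hK.closure.image continuous_modularFn).bddAbove
  unfold flipMeasure
  refine lt_of_le_of_lt (measure_mono subset_closure) ?_
  rw [withDensity_apply _ isClosed_closure.measurableSet]
  calc ∫⁻ t in closure K, ENNReal.ofReal (modularFn t) ∂μ.inv
      ≤ ∫⁻ t in closure K, ENNReal.ofReal C ∂μ.inv := by
        refine setLIntegral_mono measurable_const fun t ht => ?_
        exact ENNReal.ofReal_le_ofReal (hC ⟨t, ht, rfl⟩)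
    _ < ∞ := by
        simp only [lintegral_const, Measure.restrict_apply_univ]
        exact ENNReal.mul_lt_top ENNReal.ofReal_lt_top hK.closure.measure_lt_top

instance : (flipMeasure μ).IsOpenPosMeasure := (inv_ac_flip μ).isOpenPosMeasure

instance : (flipMeasure μ).IsHaarMeasure where

lemma integral_flip {E : Type*} [NormedAddCommGroup E] [NormedSpace ℝ E] (f : G → E) :
    ∫ t, f t ∂(flipMeasure μ) = ∫ t, modularFn t⁻¹ • f t⁻¹ ∂μ := by
  unfold flipMeasure
  rw [integral_withDensity_eq_integral_toReal_smul measurable_density (by simp)]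
  rw [Measure.inv, inv_measurableEmbedding.integral_map]
  simp [ENNReal.toReal_ofReal (modularFn_pos _).le]

lemma flip_factor : haarScalarFactor (flipMeasure μ) μ = 1 := by
  obtain ⟨f, f_comp, f_nonneg, f_one⟩ :
    ∃ f : C(G, ℝ), HasCompactSupport f ∧ 0 ≤ f ∧ f 1 ≠ 0 := exists_continuous_nonneg_pos 1
  obtain ⟨c, hc⟩ : ∃ c : ℝ, c = ((haarScalarFactor (flipMeasure μ) μ : ℝ≥0) : ℝ) := ⟨_, rfl⟩
  have hpos : 0 < ∫ x, f x ∂μ :=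
    f.continuous.integral_pos_of_hasCompactSupport_nonneg_nonzero f_comp f_nonneg f_one
  have key : ∀ h : G → ℝ, Continuous h → HasCompactSupport h →
      ∫ t, modularFn t⁻¹ * h t⁻¹ ∂μ = c * ∫ x, h x ∂μ := by
    intro h hh hs
    have e := integral_flip μ h
    rw [integral_isMulLeftInvariant_eq_smul_of_hasCompactSupport _ μ hh hs,
      integral_smul_nnreal_measure] at e
    rw [hc]; exact e.symm
  have k1 := key f f.continuous f_comp
  have k2 := key (fun t => modularFn t⁻¹ * f t⁻¹)
    ((continuous_modularFn.comp continuous_inv).mul (f.continuous.comp continuous_inv))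
    ((f_comp.comp_homeomorph (Homeomorph.inv G)).mul_left)
  have k3 : ∀ t : G, modularFn t⁻¹ * (modularFn t⁻¹⁻¹ * f t⁻¹⁻¹) = f t := by
    intro t
    rw [inv_inv, ← mul_assoc, modularFn_inv_mul_self, one_mul]
  simp only [k3] at k2
  rw [k1] at k2
  have h1 : c * c = 1 := by
    refine mul_right_cancel₀ hpos.ne' ?_
    linarith
  have h0 : (0 : ℝ) ≤ c := hc ▸ NNReal.coe_nonneg _
  have h2 : c = 1 := by nlinarith
  exact NNReal.coe_injective (hc.symm.trans h2)

lemma flip_le : flipMeasure μ ≤ μ := by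
  refine Measure.le_iff'.2 fun E => ?_
  rw [E.measure_eq_iInf_isOpen μ]
  refine le_iInf fun U => le_iInf fun hEU => le_iInf fun hU => ?_
  have := measure_isHaarMeasure_eq_smul_of_isOpen (flipMeasure μ) μ hU
  rw [flip_factor, one_smul] at this
  exact (measure_mono hEU).trans this.le

lemma qmp_inv : QuasiMeasurePreserving (Inv.inv : G → G) μ μ :=
  ⟨measurable_inv, (inv_ac_flip μ).trans (flip_le μ).absolutelyContinuous⟩

lemma qmp_inv_mul (t : G) : QuasiMeasurePreserving (fun s : G => s⁻¹ * t) μ μ := by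
  have h : QuasiMeasurePreserving (· * t) μ μ :=
    ⟨measurable_mul_const t, by
      rw [map_mul_right]
      exact Measure.smul_absolutelyContinuous⟩
  exact h.comp (qmp_inv μ)

/-- `∫ Δ(t⁻¹) f(t⁻¹) dt = ∫ f(t) dt`. -/
lemma integral_flip_real {f : G → ℝ} (hf : Continuous f) (hs : HasCompactSupport f) :
    ∫ t, modularFn t⁻¹ * f t⁻¹ ∂μ = ∫ t, f t ∂μ := by
  have := integral_flip μ f
  rw [integral_isMulLeftInvariant_eq_smul_of_hasCompactSupport _ μ hf hs, flip_factor,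
    one_smul] at this
  exact this.symm

lemma lintegral_flip_le (f : G → ℝ≥0∞) :
    ∫⁻ t, ENNReal.ofReal (modularFn t⁻¹) * f t⁻¹ ∂μ ≤ ∫⁻ t, f t ∂μ := by
  have e : ∫⁻ t, f t ∂(flipMeasure μ)
      = ∫⁻ t, ENNReal.ofReal (modularFn t⁻¹) * f t⁻¹ ∂μ := by
    unfold flipMeasure
    rw [lintegral_withDensity_eq_lintegral_mul_non_measurable _ measurable_density (by simp)]
    rw [Measure.inv, inv_measurableEmbedding.lintegral_map]
    rfl
  rw [← e]
  exact lintegral_mono' (flip_le μ) le_rfl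

end Haar

section Convolution

variable {G : Type*} [Group G] [TopologicalSpace G] [IsTopologicalGroup G]
  [LocallyCompactSpace G] [MeasurableSpace G] [BorelSpace G]

/-- Convolution `(f ∗ g)(t) = ∫ f(s) g(s⁻¹ t) ds`. -/
def conv {𝕜 : Type*} [RCLike 𝕜] (μ : Measure G) (f g : G → 𝕜) (t : G) : 𝕜 :=
  ∫ s, f s * g (s⁻¹ * t) ∂μ

/-- The involution `f^*(t) = Δ(t⁻¹) conj f(t⁻¹)`. -/
def invol (f : G → ℂ) (t : G) : ℂ := (modularFn t⁻¹ : ℂ) * star (f t⁻¹)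

section Cc

variable {𝕜 : Type*} [RCLike 𝕜] {f g h : G → 𝕜}

lemma hasCompactSupport_pair (hf : HasCompactSupport f) (hg : HasCompactSupport g) :
    HasCompactSupport fun p : G × G => f p.1 * g (p.1⁻¹ * p.2) := by
  refine HasCompactSupport.intro (K := tsupport f ×ˢ (tsupport f * tsupport g))
    (IsCompact.prod hf (IsCompact.mul hf hg)) ?_
  rintro ⟨s, t⟩ hst
  by_cases h1 : s ∈ tsupport f
  · have h2 : s⁻¹ * t ∉ tsupport g := fun h2 =>
      hst ⟨h1, Set.mem_mul.2 ⟨s, h1, s⁻¹ * t, h2, by simp⟩⟩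
    simp [image_eq_zero_of_notMem_tsupport h2]
  · simp [image_eq_zero_of_notMem_tsupport h1]

lemma hasCompactSupport_pair' (hf : HasCompactSupport f) (hg : HasCompactSupport g) :
    HasCompactSupport fun p : G × G => f p.2 * g (p.2⁻¹ * p.1) :=
  (hasCompactSupport_pair hf hg).comp_homeomorph (Homeomorph.prodComm G G)

variable (μ : Measure G)

lemma conv_eq_zero {t : G} (ht : t ∉ tsupport f * tsupport g) : conv μ f g t = 0 := by
  unfold conv
  rw [← integral_zero G 𝕜 (μ := μ)]
  congr 1
  funext s
  by_cases h1 : s ∈ tsupport f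
  · have h2 : s⁻¹ * t ∉ tsupport g := fun h2 =>
      ht (Set.mem_mul.2 ⟨s, h1, s⁻¹ * t, h2, by simp⟩)
    simp [image_eq_zero_of_notMem_tsupport h2]
  · simp [image_eq_zero_of_notMem_tsupport h1]

lemma hasCompactSupport_conv (hf : HasCompactSupport f) (hg : HasCompactSupport g) :
    HasCompactSupport (conv μ f g) :=
  HasCompactSupport.intro (IsCompact.mul hf hg) fun _ ht => conv_eq_zero μ ht

variable [μ.IsHaarMeasure]

lemma continuous_conv (cf : Continuous f) (hf : HasCompactSupport f) (cg : Continuous g) :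
    Continuous (conv μ f g) := by
  rw [← continuousOn_univ]
  refine continuousOn_integral_of_compact_support (k := tsupport f) hf ?_ ?_
  · exact Continuous.continuousOn (by fun_prop)
  · intro p x _ hx
    simp [image_eq_zero_of_notMem_tsupport hx]

lemma integrable_conv_Cc (cf : Continuous f) (hf : HasCompactSupport f) (cg : Continuous g)
    (t : G) : Integrable (fun s => f s * g (s⁻¹ * t)) μ :=
  Continuous.integrable_of_hasCompactSupport (by fun_prop) hf.mul_right

lemma integral_conv_Cc (cf : Continuous f) (hf : HasCompactSupport f) (cg : Continuous g)
    (hg : HasCompactSupport g) :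
    ∫ t, conv μ f g t ∂μ = (∫ s, f s ∂μ) * ∫ t, g t ∂μ := by
  unfold conv
  rw [integral_integral_swap_of_hasCompactSupport (f := fun t s => f s * g (s⁻¹ * t))
    (by fun_prop) (hasCompactSupport_pair' hf hg)]
  simp_rw [integral_const_mul, integral_mul_left_eq_self, integral_mul_const]

lemma conv_assoc_Cc (cf : Continuous f) (hf : HasCompactSupport f) (cg : Continuous g)
    (hg : HasCompactSupport g) (ch : Continuous h) (t : G) :
    conv μ (conv μ f g) h t = conv μ f (conv μ g h) t := by
  unfold conv
  have e1 : ∀ s, (∫ r, f r * g (r⁻¹ * s) ∂μ) * h (s⁻¹ * t)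
      = ∫ r, f r * g (r⁻¹ * s) * h (s⁻¹ * t) ∂μ := fun s => (integral_mul_const _ _).symm
  simp_rw [e1]
  rw [integral_integral_swap_of_hasCompactSupport
    (f := fun s r => f r * g (r⁻¹ * s) * h (s⁻¹ * t)) (by fun_prop)
    (HasCompactSupport.mul_right (hasCompactSupport_pair' hf hg))]
  congr 1; funext r
  simp_rw [mul_assoc (f r), integral_const_mul]
  congr 1
  rw [← integral_mul_left_eq_self _ r]
  simp [mul_assoc]

end Cc

lemma invol_conv (μ : Measure G) [μ.IsHaarMeasure] (f g : G → ℂ) (t : G) :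
    invol (conv μ f g) t = conv μ (invol g) (invol f) t := by
  unfold invol conv
  rw [← integral_mul_left_eq_self (fun s => f s * g (s⁻¹ * t⁻¹)) t⁻¹, RCLike.star_def,
    ← integral_conj, ← integral_const_mul]
  congr 1; funext s
  have h1 : (modularFn t⁻¹ : ℂ) = modularFn s⁻¹ * modularFn (t⁻¹ * s) := by
    rw [← Complex.ofReal_mul, modularFn_mul, mul_comm, mul_assoc, mul_comm (modularFn s),
      modularFn_inv_mul_self, mul_one]
  rw [h1]
  simp only [mul_inv_rev, inv_inv, mul_assoc, mul_inv_cancel, mul_one, map_mul]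
  ring

variable (μ : Measure G)

section L1

variable [μ.IsHaarMeasure] [μ.Regular]

lemma conv_congr {f f' g g' : G → ℂ} (hf : f =ᵐ[μ] f') (hg : g =ᵐ[μ] g') :
    conv μ f g = conv μ f' g' := by
  funext t
  refine integral_congr_ae ?_
  filter_upwards [hf, (qmp_inv_mul μ t).ae hg] with s h1 h2
  rw [h1, h2]

/-- `C_c(G)` is dense in `L¹(G)`. -/
lemma exists_Cc_approx {f : G → ℂ} (hf : Integrable f μ) {ε : ℝ≥0∞} (hε : ε ≠ 0) :
    ∃ g : G → ℂ, HasCompactSupport g ∧ ∫⁻ s, ‖f s - g s‖ₑ ∂μ ≤ ε ∧ Continuous g ∧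
      Integrable g μ := by
  have main : ∃ g : G → ℂ, eLpNorm (f - g) 1 μ ≤ ε ∧ (Continuous g ∧ HasCompactSupport g) := by
    refine MemLp.induction_dense ENNReal.one_ne_top
      (fun g : G → ℂ => Continuous g ∧ HasCompactSupport g) ?_
      (fun f g hf hg => ⟨hf.1.add hg.1, hf.2.add hg.2⟩)
      (fun f hf => hf.1.aestronglyMeasurable) (memLp_one_iff_integrable.2 hf) hε
    intro c t ht htμ ε hε
    obtain ⟨η, ηpos, hη⟩ := exists_eLpNorm_indicator_le (μ := μ) (p := 1) ENNReal.one_ne_top c hε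
    have hη2 : ((η : ℝ≥0∞) / 2) ≠ 0 := by simpa using ηpos.ne'
    obtain ⟨K, Kt, Kc, Kcl, Kμ⟩ := ht.exists_isCompact_isClosed_sdiff_lt htμ.ne hη2
    obtain ⟨U, KU, Uo, -, hU⟩ :=
      Kcl.measurableSet.exists_isOpen_sdiff_lt (ne_of_lt (IsCompact.measure_lt_top (μ := μ) Kc)) hη2
    obtain ⟨g, gK, gU, gs, g01⟩ := exists_continuous_one_zero_of_isCompact Kc Uo.isClosed_compl
      (Set.disjoint_compl_right_iff_subset.2 KU)
    refine ⟨fun x => g x • c, ?_, by fun_prop, gs.smul_right⟩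
    refine le_trans (eLpNorm_mono (g := ((t \ K) ∪ (U \ K)).indicator fun _ => c) fun x => ?_)
      (hη _ ?_)
    · have hg : ‖g x • c‖ ≤ ‖c‖ := by
        rw [norm_smul, Real.norm_of_nonneg (g01 x).1]
        exact mul_le_of_le_one_left (norm_nonneg _) (g01 x).2
      have hg' : ‖g x • c - c‖ ≤ ‖c‖ := by
        have : g x • c - c = -((1 - g x) • c) := by rw [sub_smul, one_smul]; ring
        rw [this, norm_neg, norm_smul, Real.norm_of_nonneg (sub_nonneg.2 (g01 x).2)]
        exact mul_le_of_le_one_left (norm_nonneg _) (by linarith [(g01 x).1])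
      by_cases hK : x ∈ K
      · have h1 : g x = 1 := gK hK
        simp [hK, Kt hK, h1]
      · by_cases hxU : x ∈ U
        · by_cases hxt : x ∈ t
          · simpa [hK, hxU, hxt] using hg'
          · simpa [hK, hxU, hxt] using hg
        · have h0 : g x = 0 := gU hxU
          by_cases hxt : x ∈ t
          · simp [hK, hxt, h0]
          · simp [hxU, hxt, h0]
    · refine (measure_union_le _ _).trans ?_
      rw [← ENNReal.add_halves (η : ℝ≥0∞)]
      exact add_le_add Kμ.le hU.le
  obtain ⟨g, h1, h2, h3⟩ := main
  refine ⟨g, h3, ?_, h2, h2.integrable_of_hasCompactSupport h3⟩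
  rw [eLpNorm_one_eq_lintegral_enorm] at h1
  exact h1

/-- Every integrable function is the almost everywhere sum of a series in `C_c(G)` whose sum
of `L¹`-norms is arbitrarily close to the `L¹`-norm of the function. -/
lemma exists_series {f : G → ℂ} (hf : Integrable f μ) {ε : ℝ≥0∞} (hε : ε ≠ 0) (hε' : ε ≠ ∞) :
    ∃ φ : ℕ → G → ℂ, (∀ n, Continuous (φ n)) ∧ (∀ n, HasCompactSupport (φ n)) ∧
      ∑' n, ∫⁻ s, ‖φ n s‖ₑ ∂μ ≤ ∫⁻ s, ‖f s‖ₑ ∂μ + ε ∧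
      ∀ᵐ s ∂μ, Summable (fun n => ‖φ n s‖) ∧ HasSum (fun n => φ n s) (f s) := by
  obtain ⟨δ, δpos, δsum⟩ := ENNReal.exists_pos_sum_of_countable' hε ℕ
  have hη : ∀ n, min (δ n) (δ (n + 1)) / 4 ≠ 0 := fun n => by
    simp [(δpos n).ne', (δpos (n + 1)).ne']
  choose u us ul uc ui using fun n => exists_Cc_approx μ hf (hη n)
  let φ : ℕ → G → ℂ := fun n => Nat.casesOn n (u 0) fun k => fun s => u (k + 1) s - u k s
  have φ0 : φ 0 = u 0 := rfl
  have φs : ∀ k, φ (k + 1) = fun s => u (k + 1) s - u k s := fun k => rfl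
  have φc : ∀ n, Continuous (φ n) := by
    rintro (_ | k)
    · exact uc 0
    · exact (uc _).sub (uc _)
  have φk : ∀ n, HasCompactSupport (φ n) := by
    rintro (_ | k)
    · exact us 0
    · exact (us _).sub (us _)
  have m : ∀ n, AEMeasurable (fun s => ‖f s - u n s‖ₑ) μ := fun n => (hf.1.sub (ui n).1).enorm
  have b0 : ∫⁻ s, ‖φ 0 s‖ₑ ∂μ ≤ ∫⁻ s, ‖f s‖ₑ ∂μ + δ 0 := by
    calc ∫⁻ s, ‖φ 0 s‖ₑ ∂μ ≤ ∫⁻ s, (‖f s‖ₑ + ‖f s - u 0 s‖ₑ) ∂μ := by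
          refine lintegral_mono fun s => ?_
          have : φ 0 s = f s - (f s - u 0 s) := by rw [φ0]; ring
          rw [this]; exact enorm_sub_le
      _ = ∫⁻ s, ‖f s‖ₑ ∂μ + ∫⁻ s, ‖f s - u 0 s‖ₑ ∂μ := lintegral_add_left' hf.1.enorm _
      _ ≤ _ := by
          gcongr
          exact (ul 0).trans ((ENNReal.div_le_of_le_mul (by
            exact (min_le_left _ _).trans (le_mul_of_one_le_right' (by norm_num)))))
  have bs : ∀ k, ∫⁻ s, ‖φ (k + 1) s‖ₑ ∂μ ≤ δ (k + 1) := by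
    intro k
    calc ∫⁻ s, ‖φ (k + 1) s‖ₑ ∂μ ≤ ∫⁻ s, (‖f s - u k s‖ₑ + ‖f s - u (k + 1) s‖ₑ) ∂μ := by
          refine lintegral_mono fun s => ?_
          have : φ (k + 1) s = (f s - u k s) - (f s - u (k + 1) s) := by rw [φs]; ring
          rw [this]; exact enorm_sub_le
      _ = ∫⁻ s, ‖f s - u k s‖ₑ ∂μ + ∫⁻ s, ‖f s - u (k + 1) s‖ₑ ∂μ := lintegral_add_left' (m k) _
      _ ≤ δ (k + 1) / 4 + δ (k + 1) / 4 := by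
          gcongr
          · exact (ul k).trans (by gcongr; exact min_le_right _ _)
          · exact (ul (k + 1)).trans (by gcongr; exact min_le_left _ _)
      _ ≤ δ (k + 1) / 2 + δ (k + 1) / 2 := by gcongr <;> norm_num
      _ = δ (k + 1) := ENNReal.add_halves _
  have hsum : ∑' n, ∫⁻ s, ‖φ n s‖ₑ ∂μ ≤ ∫⁻ s, ‖f s‖ₑ ∂μ + ε := by
    rw [tsum_eq_zero_add' ENNReal.summable]
    calc _ ≤ (∫⁻ s, ‖f s‖ₑ ∂μ + δ 0) + ∑' k, δ (k + 1) := by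
          gcongr with k
          exact bs k
      _ = ∫⁻ s, ‖f s‖ₑ ∂μ + ∑' n, δ n := by
          rw [add_assoc, ← tsum_eq_zero_add' ENNReal.summable]
      _ ≤ _ := by gcongr
  refine ⟨φ, φc, φk, hsum, ?_⟩
  have hφfin : ∀ᵐ s ∂μ, ∑' n, ‖φ n s‖ₑ < ∞ := by
    refine ae_lt_top' (AEMeasurable.tsum fun n => (φc n).aestronglyMeasurable.enorm) ?_
    rw [lintegral_tsum fun n => (φc n).aestronglyMeasurable.enorm]
    exact ne_top_of_le_ne_top (ENNReal.add_ne_top.2 ⟨hf.2.ne, hε'⟩) hsum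
  have hufin : ∀ᵐ s ∂μ, ∑' n, ‖f s - u n s‖ₑ < ∞ := by
    refine ae_lt_top' (AEMeasurable.tsum m) ?_
    rw [lintegral_tsum m]
    refine ne_top_of_le_ne_top hε' (le_trans (ENNReal.tsum_le_tsum fun n => ?_) δsum.le)
    exact (ul n).trans (ENNReal.div_le_of_le_mul
      ((min_le_left _ _).trans (le_mul_of_one_le_right' (by norm_num))))
  filter_upwards [hφfin, hufin] with s h1 h2
  have hs : Summable fun n => ‖φ n s‖ := by
    refine (ENNReal.summable_toReal h1.ne).congr fun n => ?_
    simp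
  refine ⟨hs, (hasSum_iff_tendsto_nat_of_summable_norm hs).2 ?_⟩
  have hp : ∀ n, ∑ i ∈ Finset.range (n + 1), φ i s = u n s := by
    intro n
    induction n with
    | zero => simp [φ0]
    | succ k ih => rw [Finset.sum_range_succ, ih, φs]; ring
  rw [← tendsto_add_atTop_iff_nat 1]
  simp_rw [hp]
  have h0 := ENNReal.tendsto_atTop_zero_of_tsum_ne_top h2.ne
  rw [tendsto_iff_edist_tendsto_0]
  refine h0.congr fun n => ?_
  rw [edist_comm, edist_eq_enorm_sub]

lemma lintegral_conv_Cc {φ γ : G → ℂ} (cf : Continuous φ) (hf : HasCompactSupport φ)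
    (cg : Continuous γ) (hg : HasCompactSupport γ) :
    (Measurable fun t => ∫⁻ s, ‖φ s * γ (s⁻¹ * t)‖ₑ ∂μ) ∧
    ∫⁻ t, ∫⁻ s, ‖φ s * γ (s⁻¹ * t)‖ₑ ∂μ ∂μ = (∫⁻ s, ‖φ s‖ₑ ∂μ) * ∫⁻ t, ‖γ t‖ₑ ∂μ := by
  have e : ∀ t, ∫⁻ s, ‖φ s * γ (s⁻¹ * t)‖ₑ ∂μ
      = ENNReal.ofReal (conv μ (fun s => ‖φ s‖) (fun s => ‖γ s‖) t) := by
    intro t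
    rw [← ofReal_integral_norm_eq_lintegral_enorm (integrable_conv_Cc μ cf hf cg t)]
    simp [conv]
  have c := continuous_conv μ cf.norm hf.norm cg.norm
  have i := integral_conv_Cc μ cf.norm hf.norm cg.norm hg.norm
  simp_rw [e]
  refine ⟨ENNReal.measurable_ofReal.comp c.measurable, ?_⟩
  rw [← ofReal_integral_eq_lintegral_ofReal
    (c.integrable_of_hasCompactSupport (hasCompactSupport_conv μ hf.norm hg.norm))
    (Eventually.of_forall fun t => integral_nonneg fun s => by positivity), i,
    ENNReal.ofReal_mul (integral_nonneg fun s => norm_nonneg _),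
    ofReal_integral_norm_eq_lintegral_enorm (cf.integrable_of_hasCompactSupport hf),
    ofReal_integral_norm_eq_lintegral_enorm (cg.integrable_of_hasCompactSupport hg)]

lemma conv_main {f g : G → ℂ} (hf : Integrable f μ) (hg : Integrable g μ) :
    (∀ᵐ t ∂μ, Integrable (fun s => f s * g (s⁻¹ * t)) μ) ∧
    AEStronglyMeasurable (conv μ f g) μ ∧
    ∫⁻ t, ‖conv μ f g t‖ₑ ∂μ ≤ (∫⁻ s, ‖f s‖ₑ ∂μ) * ∫⁻ t, ‖g t‖ₑ ∂μ := by
  have key : ∀ ε : ℝ≥0∞, ε ≠ 0 → ε ≠ ∞ →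
      (∀ᵐ t ∂μ, Integrable (fun s => f s * g (s⁻¹ * t)) μ) ∧
      AEStronglyMeasurable (conv μ f g) μ ∧
      ∫⁻ t, ‖conv μ f g t‖ₑ ∂μ ≤ (∫⁻ s, ‖f s‖ₑ ∂μ + ε) * (∫⁻ t, ‖g t‖ₑ ∂μ + ε) := by
    intro ε hε hε'
    obtain ⟨φ, φc, φs, φn, φh⟩ := exists_series μ hf hε hε'
    obtain ⟨γ, γc, γs, γn, γh⟩ := exists_series μ hg hε hε'
    let F : ℕ × ℕ → G → G → ℂ := fun i t s => φ i.1 s * γ i.2 (s⁻¹ * t)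
    have hFi : ∀ i t, Integrable (F i t) μ := fun i t =>
      integrable_conv_Cc μ (φc i.1) (φs i.1) (γc i.2) t
    have hFl : ∀ i, (Measurable fun t => ∫⁻ s, ‖F i t s‖ₑ ∂μ) ∧
        ∫⁻ t, ∫⁻ s, ‖F i t s‖ₑ ∂μ ∂μ = (∫⁻ s, ‖φ i.1 s‖ₑ ∂μ) * ∫⁻ t, ‖γ i.2 t‖ₑ ∂μ :=
      fun i => lintegral_conv_Cc μ (φc _) (φs _) (γc _) (γs _)
    have hT : ∫⁻ t, ∑' i, ∫⁻ s, ‖F i t s‖ₑ ∂μ ∂μ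
        ≤ (∫⁻ s, ‖f s‖ₑ ∂μ + ε) * (∫⁻ t, ‖g t‖ₑ ∂μ + ε) := by
      rw [lintegral_tsum fun i => (hFl i).1.aemeasurable]
      simp_rw [(hFl _).2]
      rw [ENNReal.tsum_prod (f := fun a b => (∫⁻ s, ‖φ a s‖ₑ ∂μ) * ∫⁻ t, ‖γ b t‖ₑ ∂μ)]
      simp_rw [ENNReal.tsum_mul_left, ENNReal.tsum_mul_right]
      exact mul_le_mul' φn γn
    have hfin : (∫⁻ s, ‖f s‖ₑ ∂μ + ε) * (∫⁻ t, ‖g t‖ₑ ∂μ + ε) ≠ ∞ :=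
      ENNReal.mul_ne_top (ENNReal.add_ne_top.2 ⟨hf.2.ne, hε'⟩)
        (ENNReal.add_ne_top.2 ⟨hg.2.ne, hε'⟩)
    have hae : ∀ᵐ t ∂μ, ∑' i, ∫⁻ s, ‖F i t s‖ₑ ∂μ < ∞ :=
      ae_lt_top (Measurable.tsum fun i => (hFl i).1) (ne_top_of_le_ne_top hfin hT)
    have hsum : ∀ t, ∀ᵐ s ∂μ, HasSum (fun i => F i t s) (f s * g (s⁻¹ * t)) := by
      intro t
      filter_upwards [φh, (qmp_inv_mul μ t).ae γh] with s h1 h2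
      exact HasSum.mul (f := fun n => φ n s) (g := fun n => γ n (s⁻¹ * t)) h1.2 h2.2
        (summable_mul_of_summable_norm (f := fun n => φ n s) (g := fun n => γ n (s⁻¹ * t))
          h1.1 h2.1)
    have hmeas : ∀ t, AEStronglyMeasurable (fun s => f s * g (s⁻¹ * t)) μ := by
      intro t
      have h := AEStronglyMeasurable.comp_quasiMeasurePreserving hg.1 (qmp_inv_mul μ t)
      exact AEStronglyMeasurable.mul hf.1 h
    have hint : ∀ᵐ t ∂μ, Integrable (fun s => f s * g (s⁻¹ * t)) μ := by
      filter_upwards [hae] with t ht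
      have h1 : ∫⁻ s, ‖f s * g (s⁻¹ * t)‖ₑ ∂μ ≤ ∫⁻ s, ∑' i, ‖F i t s‖ₑ ∂μ := by
        refine lintegral_mono_ae ?_
        filter_upwards [hsum t] with s hs
        rw [← hs.tsum_eq]
        exact enorm_tsum_le_tsum_enorm
      have h2 : ∫⁻ s, ∑' i, ‖F i t s‖ₑ ∂μ = ∑' i, ∫⁻ s, ‖F i t s‖ₑ ∂μ :=
        lintegral_tsum fun i => (hFi i t).1.enorm
      exact ⟨hmeas t, (h1.trans h2.le).trans_lt ht⟩
    have hconv : ∀ᵐ t ∂μ, HasSum (fun i => ∫ s, F i t s ∂μ) (conv μ f g t) := by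
      filter_upwards [hae] with t ht
      have hs : Summable fun i => ∫ s, ‖F i t s‖ ∂μ := by
        have := ENNReal.summable_toReal ht.ne
        refine this.congr fun i => ?_
        rw [← integral_norm_eq_lintegral_enorm (hFi i t).1]
      have e : conv μ f g t = ∫ s, ∑' i, F i t s ∂μ := by
        refine integral_congr_ae ?_
        filter_upwards [hsum t] with s hs
        exact hs.tsum_eq.symm
      rw [e]
      exact hasSum_integral_of_summable_integral_norm (fun i => hFi i t) hs
    have hFc : ∀ i, Continuous fun t => ∫ s, F i t s ∂μ := fun i =>
      continuous_conv μ (φc i.1) (φs i.1) (γc i.2)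
    refine ⟨hint, ?_, le_trans (lintegral_mono_ae ?_) hT⟩
    · exact aestronglyMeasurable_of_tendsto_ae atTop
        (fun I : Finset (ℕ × ℕ) => (continuous_finsetSum I fun i _ => hFc i).aestronglyMeasurable)
        hconv
    · filter_upwards [hconv] with t ht
      rw [← ht.tsum_eq]
      exact enorm_tsum_le_tsum_enorm.trans
        (ENNReal.tsum_le_tsum fun i => enorm_integral_le_lintegral_enorm _)
  obtain ⟨h1, h2, -⟩ := key 1 one_ne_zero ENNReal.one_ne_top
  refine ⟨h1, h2, ?_⟩
  have hlim : Tendsto (fun ε : ℝ≥0∞ => (∫⁻ s, ‖f s‖ₑ ∂μ + ε) * (∫⁻ t, ‖g t‖ₑ ∂μ + ε)) (𝓝[>] 0)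
      (𝓝 ((∫⁻ s, ‖f s‖ₑ ∂μ + 0) * (∫⁻ t, ‖g t‖ₑ ∂μ + 0))) := by
    refine Tendsto.mono_left ?_ nhdsWithin_le_nhds
    refine ENNReal.Tendsto.mul (tendsto_const_nhds.add tendsto_id) (Or.inr ?_)
      (tendsto_const_nhds.add tendsto_id) (Or.inr ?_)
    · simpa using hg.2.ne
    · simpa using hf.2.ne
  rw [add_zero, add_zero] at hlim
  refine ge_of_tendsto hlim ?_
  filter_upwards [self_mem_nhdsWithin, nhdsWithin_le_nhds (Iio_mem_nhds ENNReal.zero_lt_top)]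
    with ε h0 hε
  exact (key ε (ne_of_gt h0) (ne_of_lt hε)).2.2

lemma integrable_conv {f g : G → ℂ} (hf : Integrable f μ) (hg : Integrable g μ) :
    Integrable (conv μ f g) μ :=
  ⟨(conv_main μ hf hg).2.1, (conv_main μ hf hg).2.2.trans_lt (ENNReal.mul_lt_top hf.2 hg.2)⟩

lemma conv_add_left {f f' g : G → ℂ} (hf : Integrable f μ) (hf' : Integrable f' μ)
    (hg : Integrable g μ) : conv μ (f + f') g =ᵐ[μ] conv μ f g + conv μ f' g := by
  filter_upwards [(conv_main μ hf hg).1, (conv_main μ hf' hg).1] with t h1 h2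
  simp only [conv, Pi.add_apply, add_mul]
  exact integral_add h1 h2

lemma conv_add_right {f g g' : G → ℂ} (hf : Integrable f μ) (hg : Integrable g μ)
    (hg' : Integrable g' μ) : conv μ f (g + g') =ᵐ[μ] conv μ f g + conv μ f g' := by
  filter_upwards [(conv_main μ hf hg).1, (conv_main μ hf hg').1] with t h1 h2
  simp only [conv, Pi.add_apply, mul_add]
  exact integral_add h1 h2

lemma conv_smul_left (c : ℂ) (f g : G → ℂ) : conv μ (c • f) g = c • conv μ f g := by
  funext t
  simp only [conv, Pi.smul_apply, smul_eq_mul, mul_assoc, integral_const_mul]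

lemma conv_smul_right (c : ℂ) (f g : G → ℂ) : conv μ f (c • g) = c • conv μ f g := by
  funext t
  simp only [conv, Pi.smul_apply, smul_eq_mul, mul_left_comm _ c, integral_const_mul]

lemma invol_congr {f f' : G → ℂ} (hf : f =ᵐ[μ] f') : invol f =ᵐ[μ] invol f' := by
  filter_upwards [(qmp_inv μ).ae hf] with t h
  simp only [invol, h]

lemma lintegral_invol_le (f : G → ℂ) : ∫⁻ t, ‖invol f t‖ₑ ∂μ ≤ ∫⁻ t, ‖f t‖ₑ ∂μ := by
  refine le_trans (le_of_eq (lintegral_congr fun t => ?_)) (lintegral_flip_le μ fun t => ‖f t‖ₑ)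
  rw [invol, enorm_mul, ← ofReal_norm (modularFn t⁻¹ : ℂ), Complex.norm_real,
    Real.norm_of_nonneg (modularFn_pos _).le, RCLike.star_def, RCLike.enorm_conj]

lemma integrable_invol {f : G → ℂ} (hf : Integrable f μ) : Integrable (invol f) μ := by
  refine ⟨?_, (lintegral_invol_le μ f).trans_lt hf.2⟩
  have h1 : AEStronglyMeasurable (fun t => f t⁻¹) μ :=
    AEStronglyMeasurable.comp_quasiMeasurePreserving hf.1 (qmp_inv μ)
  have h2 : AEStronglyMeasurable (fun t : G => (modularFn t⁻¹ : ℂ)) μ :=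
    (Complex.continuous_ofReal.comp
      (continuous_modularFn.comp continuous_inv)).aestronglyMeasurable
  exact h2.mul (continuous_star.comp_aestronglyMeasurable h1)

lemma invol_invol (f : G → ℂ) : invol (invol f) = f := by
  funext t
  have := modularFn_inv_mul_self t
  simp only [invol, inv_inv, RCLike.star_def, map_mul, Complex.conj_ofReal, RCLike.conj_conj]
  rw [← mul_assoc, ← Complex.ofReal_mul, this]
  simp

lemma integral_invol_Cc {f : G → ℂ} (cf : Continuous f) (hf : HasCompactSupport f) :
    ∫ t, invol f t ∂μ = star (∫ t, f t ∂μ) := by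
  have hi : ∀ {g : G → ℂ}, Continuous g → HasCompactSupport g → Integrable g μ :=
    fun h h' => h.integrable_of_hasCompactSupport h'
  have hfi := hi cf hf
  have hvi := integrable_invol μ hfi
  have h1 := integral_flip_real μ (Complex.continuous_re.comp cf) (hf.comp_left Complex.zero_re)
  have h2 := integral_flip_real μ (Complex.continuous_im.comp cf) (hf.comp_left Complex.zero_im)
  have r1 : (∫ t, invol f t ∂μ).re = ∫ t, (invol f t).re ∂μ := (integral_re hvi).symm
  have r2 : (∫ t, invol f t ∂μ).im = ∫ t, (invol f t).im ∂μ := (integral_im hvi).symm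
  have r3 : (∫ t, f t ∂μ).re = ∫ t, (f t).re ∂μ := (integral_re hfi).symm
  have r4 : (∫ t, f t ∂μ).im = ∫ t, (f t).im ∂μ := (integral_im hfi).symm
  simp only [Function.comp_apply] at h1 h2
  apply Complex.ext
  · rw [r1, RCLike.star_def, Complex.conj_re, r3, ← h1]
    simp [invol]
  · rw [r2, RCLike.star_def, Complex.conj_im, r4, ← h2, ← integral_neg]
    simp [invol]

lemma continuous_invol {f : G → ℂ} (cf : Continuous f) : Continuous (invol f) :=
  (Complex.continuous_ofReal.comp (continuous_modularFn.comp continuous_inv)).mul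
    (continuous_star.comp (cf.comp continuous_inv))

lemma hasCompactSupport_invol {f : G → ℂ} (hf : HasCompactSupport f) :
    HasCompactSupport (invol f) :=
  ((hf.comp_homeomorph (Homeomorph.inv G)).comp_left (g := star) (star_zero ℂ)).mul_left

end L1

end Convolution

section Algebras

open scoped CompactlySupported

variable {G : Type*} [Group G] [TopologicalSpace G] [IsTopologicalGroup G]
  [LocallyCompactSpace G] [MeasurableSpace G] [BorelSpace G]

/-- The vector space `C_c(G)`, to be given the convolution product, the involution
`f^*(t) = Δ(t⁻¹) conj f(t⁻¹)` and the inductive topology `𝔗`. -/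
def CcG (_μ : Measure G) : Type _ := C_c(G, ℂ)

/-- The Banach space `L¹(G)`, to be given the convolution product and the involution
`f^*(t) = Δ(t⁻¹) conj f(t⁻¹)`. -/
def L1G (μ : Measure G) : Type _ := Lp ℂ 1 μ

variable (μ : Measure G)

namespace CcG

instance : AddCommGroup (CcG μ) := inferInstanceAs (AddCommGroup C_c(G, ℂ))
instance : Module ℂ (CcG μ) := inferInstanceAs (Module ℂ C_c(G, ℂ))
instance : FunLike (CcG μ) G ℂ := inferInstanceAs (FunLike C_c(G, ℂ) G ℂ)

variable {μ}

@[ext] lemma ext {f g : CcG μ} (h : ∀ t, f t = g t) : f = g := DFunLike.ext _ _ h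

@[simp] lemma add_apply (f g : CcG μ) (t : G) : (f + g) t = f t + g t := rfl
@[simp] lemma zero_apply (t : G) : (0 : CcG μ) t = 0 := rfl
@[simp] lemma smul_apply (c : ℂ) (f : CcG μ) (t : G) : (c • f) t = c * f t := rfl

lemma continuous (f : CcG μ) : Continuous f := ContinuousMap.continuous (CompactlySupportedContinuousMap.toContinuousMap f)
lemma hasCompactSupport (f : CcG μ) : HasCompactSupport f :=
  CompactlySupportedContinuousMap.hasCompactSupport f

variable [μ.IsHaarMeasure]

lemma integrable (f : CcG μ) : Integrable f μ :=
  f.continuous.integrable_of_hasCompactSupport f.hasCompactSupport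

instance : Mul (CcG μ) where
  mul f g := (⟨⟨conv μ f g, continuous_conv μ f.continuous f.hasCompactSupport g.continuous⟩,
    hasCompactSupport_conv μ f.hasCompactSupport g.hasCompactSupport⟩ : C_c(G, ℂ))

lemma mul_apply (f g : CcG μ) (t : G) : (f * g) t = ∫ s, f s * g (s⁻¹ * t) ∂μ := rfl

lemma coe_mul (f g : CcG μ) : ⇑(f * g) = conv μ f g := rfl

instance : NonUnitalRing (CcG μ) where
  left_distrib f g h := by
    ext t
    simp only [mul_apply, add_apply, mul_add]
    exact integral_add (integrable_conv_Cc μ f.continuous f.hasCompactSupport g.continuous t)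
      (integrable_conv_Cc μ f.continuous f.hasCompactSupport h.continuous t)
  right_distrib f g h := by
    ext t
    simp only [mul_apply, add_apply, add_mul]
    exact integral_add (integrable_conv_Cc μ f.continuous f.hasCompactSupport h.continuous t)
      (integrable_conv_Cc μ g.continuous g.hasCompactSupport h.continuous t)
  zero_mul f := by ext t; simp [mul_apply]
  mul_zero f := by ext t; simp [mul_apply]
  mul_assoc f g h := by
    ext t
    simp only [coe_mul]
    exact conv_assoc_Cc μ f.continuous f.hasCompactSupport g.continuous g.hasCompactSupport
      h.continuous t

instance : IsScalarTower ℂ (CcG μ) (CcG μ) where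
  smul_assoc c f g := by
    ext t
    simp only [smul_eq_mul, mul_apply, smul_apply, mul_assoc, integral_const_mul]

instance : SMulCommClass ℂ (CcG μ) (CcG μ) where
  smul_comm c f g := by
    ext t
    simp only [smul_eq_mul, mul_apply, smul_apply, mul_left_comm _ c, integral_const_mul]

instance : Star (CcG μ) where
  star f := (⟨⟨invol f, continuous_invol f.continuous⟩,
    hasCompactSupport_invol f.hasCompactSupport⟩ : C_c(G, ℂ))

lemma star_apply (f : CcG μ) (t : G) : (star f) t = (modularFn t⁻¹ : ℂ) * star (f t⁻¹) := rfl

lemma coe_star (f : CcG μ) : ⇑(star f) = invol f := rfl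

instance : StarRing (CcG μ) where
  star_involutive f := by
    ext t
    rw [coe_star, coe_star, invol_invol]
  star_mul f g := by
    ext t
    rw [coe_star, coe_mul, coe_mul, coe_star, coe_star]
    exact invol_conv μ f g t
  star_add f g := by
    ext t
    simp [star_apply, mul_add]

instance : StarModule ℂ (CcG μ) where
  star_smul c f := by
    ext t
    simp only [star_apply, smul_apply, star_mul']
    ring

variable (μ)

/-- The subspace `C_K(G)` of functions with support in `K`. -/
def supportedIn (K : Set G) : Submodule ℂ (CcG μ) where
  carrier := {f | tsupport f ⊆ K}
  zero_mem' := by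
    change tsupport (fun _ : G => (0 : ℂ)) ⊆ K
    simp [tsupport]
  add_mem' {f g} hf hg := (tsupport_add f g).trans (Set.union_subset hf hg)
  smul_mem' c f hf := (tsupport_smul_subset_right (fun _ => c) f).trans hf

/-- The topology of the `L¹`-norm on `C_K(G)`. -/
abbrev topologyOn (K : Set G) : TopologicalSpace (supportedIn μ K) :=
  TopologicalSpace.induced (fun f => Integrable.toL1 (f : CcG μ) (integrable (f : CcG μ)))
    (inferInstance : TopologicalSpace (Lp ℂ 1 μ))

/-- The topology `𝔗` on `C_c(G)`: the locally convex inductive limit of the spaces `C_K(G)` with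
their `L¹`-norms, i.e. the finest locally convex vector space topology on `C_c(G)` for which
all the inclusions `C_K(G) → C_c(G)`, `K` compact, are continuous. -/
instance : TopologicalSpace (CcG μ) :=
  sInf {T : TopologicalSpace (CcG μ) |
    (∀ K : Set G, IsCompact K → @Continuous _ _ (topologyOn μ K) T (Subtype.val)) ∧
    @IsTopologicalAddGroup (CcG μ) T _ ∧ @ContinuousSMul ℂ (CcG μ) _ _ T ∧
    @LocallyConvexSpace ℝ (CcG μ) _ _ _ (Module.complexToReal (CcG μ)) T}

instance : IsTopologicalAddGroup (CcG μ) := topologicalAddGroup_sInf fun _ h => h.2.1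
instance : ContinuousSMul ℂ (CcG μ) := continuousSMul_sInf fun _ h => h.2.2.1
instance : LocallyConvexSpace ℝ (CcG μ) := .sInf fun _ h => h.2.2.2

variable {μ} [μ.Regular]

/-- The `*`-character `ε_G` of `C_c(G)` given by integration. -/
def eps : CcG μ →⋆ₙₐ[ℂ] ℂ where
  toFun f := ∫ t, f t ∂μ
  map_smul' c f := by simp [integral_const_mul]
  map_zero' := by simp
  map_add' f g := by
    simp only [add_apply]
    exact integral_add f.integrable g.integrable
  map_mul' f g := integral_conv_Cc μ f.continuous f.hasCompactSupport g.continuous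
    g.hasCompactSupport
  map_star' f := integral_invol_Cc μ f.continuous f.hasCompactSupport

end CcG

namespace L1G

instance : NormedAddCommGroup (L1G μ) := inferInstanceAs (NormedAddCommGroup (Lp ℂ 1 μ))
instance : NormedSpace ℂ (L1G μ) := inferInstanceAs (NormedSpace ℂ (Lp ℂ 1 μ))
instance : CompleteSpace (L1G μ) := inferInstanceAs (CompleteSpace (Lp ℂ 1 μ))
instance : CoeFun (L1G μ) (fun _ => G → ℂ) where
  coe f := @Subtype.val (G →ₘ[μ] ℂ) (· ∈ Lp ℂ 1 μ) f

variable {μ}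

/-- The class of an integrable function. -/
def mk (f : G → ℂ) (hf : Integrable f μ) : L1G μ := Integrable.toL1 f hf

lemma coeFn_mk (f : G → ℂ) (hf : Integrable f μ) : mk f hf =ᵐ[μ] f := Integrable.coeFn_toL1 hf

lemma integrable (f : L1G μ) : Integrable f μ := L1.integrable_coeFn f

lemma mk_coe (f : L1G μ) : mk f f.integrable = f := Integrable.toL1_coeFn f f.integrable

lemma mk_eq {f g : G → ℂ} (hf : Integrable f μ) (hg : Integrable g μ) :
    mk f hf = mk g hg ↔ f =ᵐ[μ] g := Integrable.toL1_eq_toL1_iff f g hf hg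

lemma mk_add {f g : G → ℂ} (hf : Integrable f μ) (hg : Integrable g μ) :
    mk f hf + mk g hg = mk (f + g) (hf.add hg) := (Integrable.toL1_add f g hf hg).symm

lemma mk_smul {f : G → ℂ} (hf : Integrable f μ) (c : ℂ) :
    c • mk f hf = mk (c • f) (hf.smul c) := (Integrable.toL1_smul f hf c).symm

lemma mk_zero : mk (0 : G → ℂ) (integrable_zero G ℂ μ) = 0 := Integrable.toL1_zero _

lemma norm_mk {f : G → ℂ} (hf : Integrable f μ) :
    ‖mk f hf‖ = (∫⁻ s, ‖f s‖ₑ ∂μ).toReal := by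
  have := Integrable.norm_toL1 f hf
  simp only [edist_zero_right] at this
  exact this

lemma ind {p : L1G μ → Prop} (h : ∀ f (hf : Integrable f μ), p (mk f hf)) (f : L1G μ) : p f := by
  rw [← mk_coe f]; exact h _ _

variable [μ.IsHaarMeasure] [μ.Regular]

/-- The convolution product of `L¹(G)`: the class of `t ↦ ∫ f(s) g(s⁻¹ t) ds`. -/
instance : Mul (L1G μ) where
  mul f g := mk (conv μ f g) (integrable_conv μ f.integrable g.integrable)

/-- The involution of `L¹(G)`: the class of `t ↦ Δ(t⁻¹) conj f(t⁻¹)`. -/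
instance : Star (L1G μ) where
  star f := mk (invol f) (integrable_invol μ f.integrable)

lemma mk_mul {f g : G → ℂ} (hf : Integrable f μ) (hg : Integrable g μ) :
    mk f hf * mk g hg = mk (conv μ f g) (integrable_conv μ hf hg) :=
  (mk_eq _ _).2 (Eventually.of_forall
    (congrFun (conv_congr μ (coeFn_mk f hf) (coeFn_mk g hg))))

lemma star_mk {f : G → ℂ} (hf : Integrable f μ) :
    star (mk f hf) = mk (invol f) (integrable_invol μ hf) :=
  (mk_eq _ _).2 (invol_congr μ (coeFn_mk f hf))

lemma norm_mul_le' (f g : L1G μ) : ‖f * g‖ ≤ ‖f‖ * ‖g‖ := by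
  induction f using ind with | _ f hf
  induction g using ind with | _ g hg
  rw [mk_mul, norm_mk, norm_mk, norm_mk, ← ENNReal.toReal_mul]
  exact ENNReal.toReal_mono (ENNReal.mul_ne_top hf.2.ne hg.2.ne) (conv_main μ hf hg).2.2

lemma norm_star_le (f : L1G μ) : ‖star f‖ ≤ ‖f‖ := by
  induction f using ind with | _ f hf
  rw [star_mk, norm_mk, norm_mk]
  exact ENNReal.toReal_mono hf.2.ne (lintegral_invol_le μ f)

lemma left_distrib' (f g h : L1G μ) : f * (g + h) = f * g + f * h := by
  induction f using ind with | _ f hf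
  induction g using ind with | _ g hg
  induction h using ind with | _ h hh
  rw [mk_add, mk_mul, mk_mul, mk_mul, mk_add, mk_eq]
  exact conv_add_right μ hf hg hh

lemma right_distrib' (f g h : L1G μ) : (f + g) * h = f * h + g * h := by
  induction f using ind with | _ f hf
  induction g using ind with | _ g hg
  induction h using ind with | _ h hh
  rw [mk_add, mk_mul, mk_mul, mk_mul, mk_add, mk_eq]
  exact conv_add_left μ hf hg hh

lemma smul_mul' (c : ℂ) (f g : L1G μ) : (c • f) * g = c • (f * g) := by
  induction f using ind with | _ f hf
  induction g using ind with | _ g hg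
  rw [mk_smul, mk_mul, mk_mul, mk_smul, mk_eq, conv_smul_left]

lemma mul_smul' (c : ℂ) (f g : L1G μ) : f * (c • g) = c • (f * g) := by
  induction f using ind with | _ f hf
  induction g using ind with | _ g hg
  rw [mk_smul, mk_mul, mk_mul, mk_smul, mk_eq, conv_smul_right]

lemma star_add' (f g : L1G μ) : star (f + g) = star f + star g := by
  induction f using ind with | _ f hf
  induction g using ind with | _ g hg
  rw [mk_add, star_mk, star_mk, star_mk, mk_add, mk_eq]
  exact Eventually.of_forall fun t => by simp [invol, mul_add]

lemma star_smul' (c : ℂ) (f : L1G μ) : star (c • f) = star c • star f := by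
  induction f using ind with | _ f hf
  rw [mk_smul, star_mk, star_mk, mk_smul, mk_eq]
  exact Eventually.of_forall fun t => by simp [invol]; ring

lemma star_star' (f : L1G μ) : star (star f) = f := by
  induction f using ind with | _ f hf
  rw [star_mk, star_mk, mk_eq, invol_invol]

/-- Convolution as a bounded bilinear map. -/
def mulL : L1G μ →L[ℂ] L1G μ →L[ℂ] L1G μ :=
  LinearMap.mkContinuous₂ (LinearMap.mk₂ ℂ (fun f g : L1G μ => f * g) right_distrib' smul_mul'
    left_distrib' mul_smul') 1 fun f g => by simpa using norm_mul_le' f g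

lemma continuous_mul' : Continuous fun p : L1G μ × L1G μ => p.1 * p.2 :=
  (mulL (μ := μ)).continuous₂

lemma continuous_star' : Continuous (star : L1G μ → L1G μ) := by
  refine (LipschitzWith.of_dist_le_mul (K := 1) fun f g => ?_).continuous
  have h : star f - star g = star (f - g) := by
    rw [sub_eq_add_neg, sub_eq_add_neg, star_add', ← neg_one_smul ℂ g, star_smul']
    simp
  rw [dist_eq_norm, dist_eq_norm, h]
  simpa using norm_star_le (f - g)

/-- The canonical map `C_c(G) → L¹(G)`. -/
def ofCc (f : CcG μ) : L1G μ := mk f (CcG.integrable f)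

lemma denseRange_ofCc : DenseRange (ofCc : CcG μ → L1G μ) := by
  refine Metric.denseRange_iff.2 fun x r hr => ?_
  induction x using ind with | _ f hf
  obtain ⟨g, gs, gl, gc, gi⟩ := exists_Cc_approx μ hf (ε := ENNReal.ofReal (r / 2)) (by simpa)
  refine ⟨(⟨⟨g, gc⟩, gs⟩ : C_c(G, ℂ)), ?_⟩
  have e : mk f hf - ofCc (⟨⟨g, gc⟩, gs⟩ : C_c(G, ℂ)) = mk (f - g) (hf.sub gi) :=
    (Integrable.toL1_sub f g hf gi).symm
  rw [dist_eq_norm, e, norm_mk]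
  have : (∫⁻ s, ‖(f - g) s‖ₑ ∂μ).toReal ≤ r / 2 := ENNReal.toReal_le_of_le_ofReal (by positivity) gl
  linarith

instance : NonUnitalNormedRing (L1G μ) where
  left_distrib := left_distrib'
  right_distrib := right_distrib'
  zero_mul f := by simpa using smul_mul' (0 : ℂ) 0 f
  mul_zero f := by simpa using mul_smul' (0 : ℂ) f 0
  mul_assoc := by
    refine denseRange_ofCc.induction_on₃ ?_ fun f g h => ?_
    · refine isClosed_eq ?_ ?_
      · exact continuous_mul'.comp ((continuous_mul'.comp
          (continuous_fst.prodMk (continuous_fst.comp continuous_snd))).prodMk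
          (continuous_snd.comp continuous_snd))
      · exact continuous_mul'.comp (continuous_fst.prodMk (continuous_mul'.comp continuous_snd))
    · simp only [ofCc, mk_mul, mk_eq]
      exact Eventually.of_forall fun t => conv_assoc_Cc μ f.continuous f.hasCompactSupport
        g.continuous g.hasCompactSupport h.continuous t
  dist_eq := NormedAddCommGroup.dist_eq
  norm_mul_le := norm_mul_le'

instance : IsScalarTower ℂ (L1G μ) (L1G μ) where
  smul_assoc := smul_mul'

instance : SMulCommClass ℂ (L1G μ) (L1G μ) where
  smul_comm c f g := (mul_smul' c f g).symm

instance : StarRing (L1G μ) where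
  star_involutive := star_star'
  star_mul f g := by
    induction f using ind with | _ f hf
    induction g using ind with | _ g hg
    rw [mk_mul, star_mk, star_mk, star_mk, mk_mul, mk_eq]
    exact Eventually.of_forall fun t => invol_conv μ f g t
  star_add := star_add'

instance : StarModule ℂ (L1G μ) where
  star_smul := star_smul'

lemma continuous_integral' : Continuous fun f : L1G μ => ∫ t, f t ∂μ :=
  continuous_integral

lemma integral_mk {f : G → ℂ} (hf : Integrable f μ) : ∫ t, mk f hf t ∂μ = ∫ t, f t ∂μ :=
  integral_congr_ae (coeFn_mk f hf)

/-- The `*`-character `ε_G` of `L¹(G)` given by integration. -/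
def eps : L1G μ →⋆ₙₐ[ℂ] ℂ where
  toFun f := ∫ t, f t ∂μ
  map_smul' c f := by
    induction f using ind with | _ f hf
    rw [mk_smul, integral_mk, integral_mk]
    exact integral_const_mul c f
  map_zero' := by rw [← mk_zero, integral_mk]; simp
  map_add' f g := by
    induction f using ind with | _ f hf
    induction g using ind with | _ g hg
    rw [mk_add, integral_mk, integral_mk, integral_mk]
    exact integral_add hf hg
  map_mul' := by
    refine denseRange_ofCc.induction_on₂ ?_ fun f g => ?_
    · exact isClosed_eq (continuous_integral'.comp continuous_mul')
        ((continuous_integral'.comp continuous_fst).mul (continuous_integral'.comp continuous_snd))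
    · simp only [ofCc, mk_mul, integral_mk]
      exact integral_conv_Cc μ f.continuous f.hasCompactSupport g.continuous g.hasCompactSupport
  map_star' f := by
    refine denseRange_ofCc.induction_on f ?_ fun f => ?_
    · exact isClosed_eq (continuous_integral'.comp continuous_star')
        (continuous_star.comp continuous_integral')
    · simp only [ofCc, star_mk, integral_mk]
      exact integral_invol_Cc μ f.continuous f.hasCompactSupport

end L1G

end Algebras

section Properties

/-- Property `(FH)` of a topological `*`-algebra `A` with a `*`-character `ε`: for every continuous
`*`-representation `Φ` of `A` on a Hilbert space `H` (norm topology on `L(H)`), every continuous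
`(Φ, ε)`-derivation `θ : A → H` is inner. -/
def PropertyFH (A : Type u) [NonUnitalRing A] [StarRing A] [Module ℂ A] [TopologicalSpace A]
    (ε : A →⋆ₙₐ[ℂ] ℂ) : Prop :=
  ∀ (H : Type v) [NormedAddCommGroup H] [InnerProductSpace ℂ H] [CompleteSpace H]
    (Φ : A →⋆ₙₐ[ℂ] (H →L[ℂ] H)) (θ : A →ₗ[ℂ] H), Continuous Φ → Continuous θ →
    (∀ a b : A, θ (a * b) = Φ a (θ b) + ε b • θ a) →
    ∃ ξ : H, ∀ a : A, θ a = ε a • ξ - Φ a ξ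

/-- Property `(CH)` of a topological `*`-algebra `A`: for every continuous `*`-representation `Φ`
of `A` on a Hilbert space `H` (norm topology on `L(H)`), every continuous left `A`-module map
`Λ : A → H` is of the form `a ↦ Φ(a) ξ`. -/
def PropertyCH (A : Type u) [NonUnitalRing A] [StarRing A] [Module ℂ A]
    [TopologicalSpace A] : Prop :=
  ∀ (H : Type v) [NormedAddCommGroup H] [InnerProductSpace ℂ H] [CompleteSpace H]
    (Φ : A →⋆ₙₐ[ℂ] (H →L[ℂ] H)) (Λ : A →ₗ[ℂ] H), Continuous Φ → Continuous Λ →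
    (∀ a b : A, Λ (a * b) = Φ a (Λ b)) →
    ∃ ξ : H, ∀ a : A, Λ a = Φ a ξ

/-- The kernel of a `*`-character, as a `*`-subalgebra. -/
def charKer {A : Type u} [NonUnitalRing A] [StarRing A] [Module ℂ A]
    (ε : A →⋆ₙₐ[ℂ] ℂ) : NonUnitalStarSubalgebra ℂ A where
  carrier := {a | ε a = 0}
  add_mem' {a b} ha hb := by
    have ha : ε a = 0 := ha
    have hb : ε b = 0 := hb
    change ε (a + b) = 0
    rw [map_add, ha, hb, add_zero]
  zero_mem' := map_zero ε
  mul_mem' {a b} ha hb := by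
    have ha : ε a = 0 := ha
    change ε (a * b) = 0
    rw [map_mul, ha, zero_mul]
  smul_mem' c a ha := by
    have ha : ε a = 0 := ha
    change ε (c • a) = 0
    rw [map_smul, ha, smul_zero]
  star_mem' {a} ha := by
    have ha : ε a = 0 := ha
    change ε (star a) = 0
    rw [map_star, ha, star_zero]

section Group

variable {G : Type u} [Group G] [TopologicalSpace G]

/-- A unitary representation is continuous if its orbit maps are norm-continuous. -/
def IsContRep {H : Type v} [NormedAddCommGroup H] [InnerProductSpace ℂ H] [CompleteSpace H]
    (π : G →* unitary (H →L[ℂ] H)) : Prop :=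
  ∀ x : H, Continuous fun t : G => (π t : H →L[ℂ] H) x

variable (G) in
/-- Property `(T)`: every continuous unitary representation of `G` having almost invariant unit
vectors has a non-zero invariant vector. -/
def PropertyT : Prop :=
  ∀ (H : Type v) [NormedAddCommGroup H] [InnerProductSpace ℂ H] [CompleteSpace H]
    (π : G →* unitary (H →L[ℂ] H)), IsContRep π →
    (∀ K : Set G, IsCompact K → ∀ δ : ℝ, 0 < δ →
      ∃ ξ : H, ‖ξ‖ = 1 ∧ ∀ t ∈ K, ‖(π t : H →L[ℂ] H) ξ - ξ‖ < δ) →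
    ∃ ξ : H, ξ ≠ 0 ∧ ∀ t : G, (π t : H →L[ℂ] H) ξ = ξ

variable [IsTopologicalGroup G] [LocallyCompactSpace G] [MeasurableSpace G] [BorelSpace G]
variable (μ : Measure G) [μ.IsHaarMeasure]

/-- The direct sum topology on the unitalization of `C_c(G)` with the topology `𝔗`. -/
instance : TopologicalSpace (Unitization ℂ (CcG μ)) :=
  TopologicalSpace.induced (fun a => (a.fst, a.snd)) (inferInstance : TopologicalSpace (ℂ × CcG μ))

variable {μ} in
/-- The unital extension to the unitalization of `C_c(G)` of the integrated form
`π̂(f) x = ∫ f(t) π(t) x dt` of a unitary representation `π`. -/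
def integratedForm {H : Type v} [NormedAddCommGroup H] [InnerProductSpace ℂ H] [CompleteSpace H]
    (π : G →* unitary (H →L[ℂ] H)) (a : Unitization ℂ (CcG μ)) (x : H) : H :=
  a.fst • x + ∫ t, a.snd t • (π t : H →L[ℂ] H) x ∂μ

variable [μ.Regular]

/-- The extension of `ε_G` to a unital `*`-character of the unitalization of `C_c(G)`. -/
def epsTilde : Unitization ℂ (CcG μ) →⋆ₙₐ[ℂ] ℂ :=
  (Unitization.starLift (CcG.eps (μ := μ))).toNonUnitalStarAlgHom

lemma epsTilde_apply (a : Unitization ℂ (CcG μ)) :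
    epsTilde μ a = a.fst + ∫ t, a.snd t ∂μ := rfl

/-- `C_c^0(G)`: the functions in `C_c(G)` with integral zero. -/
abbrev Cc0 : NonUnitalStarSubalgebra ℂ (CcG μ) := charKer (CcG.eps (μ := μ))

/-- The augmentation ideal `C̃_c^0(G) = {(f, λ) | λ = - ∫ f}` of the unitalization of `C_c(G)`. -/
abbrev CcTilde0 : NonUnitalStarSubalgebra ℂ (Unitization ℂ (CcG μ)) := charKer (epsTilde μ)

/-- Every continuous `C̃_c^0(G)`-module map into the space of a continuous unitary representation
of `G` is of the form `a ↦ π̂(a) ξ`. -/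
def PropertyCHRep : Prop :=
  ∀ (H : Type v) [NormedAddCommGroup H] [InnerProductSpace ℂ H] [CompleteSpace H]
    (π : G →* unitary (H →L[ℂ] H)) (Ξ : CcTilde0 μ →ₗ[ℂ] H), IsContRep π → Continuous Ξ →
    (∀ a b : CcTilde0 μ, Ξ (a * b) = integratedForm π (a : Unitization ℂ (CcG μ)) (Ξ b)) →
    ∃ ξ : H, ∀ a : CcTilde0 μ, Ξ a = integratedForm π (a : Unitization ℂ (CcG μ)) ξ

end Group

end Properties

end

end GroupAlg

namespace GroupAlg

open MeasureTheory MeasureTheory.Measure Filter Topology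
open scoped ENNReal NNReal Pointwise

noncomputable section

set_option linter.unusedSectionVars false
set_option linter.overlappingInstances false

/-! ### Chebyshev centres, bounded cocycles, and unitaries built from Gram matrices -/

section Hilbert

open scoped ComplexOrder InnerProductSpace Matrix

variable {H : Type v} [NormedAddCommGroup H] [InnerProductSpace ℂ H]

/-! A derivation of `C_c(G)` is integration against a cocycle of `G`. Formally θ(f) = ∫ f(t) b(t)
dt, where b is recovered from θ(λ_t g) = π(t) θ(g) + b(t) for one fixed g of integral 1, and θ is
inner as soon as b is a coboundary (`CcG.exists_cocycle_of_derivation`). Continuity for 𝔗 bounds θ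
only on each C_K(G) and yields a continuous b; continuity for the L¹-norm bounds b on all of G. This
separates (a) from (b).

For (a), the affine isometries x ↦ π(s)x + b(s) permute the bounded set b(G), hence fix its
Chebyshev centre, so b is a coboundary for any G (`coboundary_of_bounded`). Density of `C_c(G)` in
L¹(G) gives the rest.

For 1 → 2, b may a priori be unbounded, and Delorme's argument (`coboundary_of_propertyT`) excludes
this. The affine action on H becomes a unitary action on a direct sum of Gaussian spaces, spanned by
vectors e(n, v) with Gram kernel exp(-s_n²‖v - w‖²) and s_n → 0. The vectors e(n, 0) are almost
invariant because s_n → 0. If b were unbounded, matrix coefficients would tend to 0 along a sequence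
in G, so no non-zero vector could be invariant, against property (T).

For 2 → 3, the bijection f ↦ f - ε(f) of `C_c(G)` onto the augmentation ideal turns module maps into
derivations. Condition 4 is condition 3 for integrated forms.

For 4 → 1 and (c), Guichardet's construction (`exists_outer_module_map`) takes unit vectors ξ_n,
ever more invariant on an exhaustion of G by compact sets. The sequence (n ξ_n) is not square
summable, but a ↦ (n π̂(a) ξ_n) takes values in the Hilbert sum and is continuous for 𝔗. A vector
implementing this map would agree with n ξ_n in coordinate n up to an invariant vector, that is,
exactly. It suffices to test on functions of integral zero, which is why (c) follows too.

Two tools recur: `exists_unitary_rep` builds unitary representations from an action on a total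
family, and `CcG.map_mul_eq_integral` rewrites T(f ∗ g) as ∫ f(t) T(λ_t g) dt. -/

lemma norm_midpoint_sub_sq (x y z : H) :
    ‖(2 : ℂ)⁻¹ • (x + y) - z‖ ^ 2
      = ‖x - z‖ ^ 2 / 2 + ‖y - z‖ ^ 2 / 2 - ‖x - y‖ ^ 2 / 4 := by
  have h := parallelogram_law_with_norm ℂ (x - z) (y - z)
  have e1 : x - z + (y - z) = (2 : ℂ) • ((2 : ℂ)⁻¹ • (x + y) - z) := by
    rw [smul_sub, smul_smul, two_smul ℂ z]; simp; abel
  have e2 : x - z - (y - z) = x - y := by abel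
  rw [e1, e2, norm_smul, Complex.norm_ofNat] at h
  linarith

/-- A bounded family in a Hilbert space has a unique Chebyshev centre. -/
lemma exists_chebyshev_center [CompleteSpace H] {ι : Type*} [Nonempty ι] (b : ι → H)
    (hb : ∃ C, ∀ i, ‖b i‖ ≤ C) :
    ∃ c : H, ∀ x : H, (∀ r : ℝ, (∀ i, ‖c - b i‖ ≤ r) → ∀ i, ‖x - b i‖ ≤ r) → x = c := by
  obtain ⟨C, hC⟩ := hb
  let R : H → ℝ := fun x => ⨆ i, ‖x - b i‖ ^ 2
  have bdd : ∀ x, BddAbove (Set.range fun i => ‖x - b i‖ ^ 2) := by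
    refine fun x => ⟨(‖x‖ + C) ^ 2, ?_⟩
    rintro _ ⟨i, rfl⟩
    have h : ‖x - b i‖ ≤ ‖x‖ + C := (norm_sub_le _ _).trans (by gcongr; exact hC i)
    exact pow_le_pow_left₀ (norm_nonneg _) h 2
  have leR : ∀ x i, ‖x - b i‖ ^ 2 ≤ R x := fun x i => le_ciSup (bdd x) i
  have R0 : ∀ x, 0 ≤ R x := fun x => (sq_nonneg _).trans (leR x (Classical.arbitrary ι))
  -- The parallelogram identity survives the supremum, so R is uniformly convex. This forces
  -- minimising sequences to be Cauchy and makes the minimiser unique.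
  have mid : ∀ x y, R ((2 : ℂ)⁻¹ • (x + y)) ≤ R x / 2 + R y / 2 - ‖x - y‖ ^ 2 / 4 := by
    refine fun x y => ciSup_le fun i => ?_
    rw [norm_midpoint_sub_sq]
    linarith [leR x i, leR y i]
  let ρ : ℝ := ⨅ x, R x
  have ρle : ∀ x, ρ ≤ R x := fun x => ciInf_le ⟨0, by rintro _ ⟨y, rfl⟩; exact R0 y⟩ x
  have key : ∀ x y, ‖x - y‖ ^ 2 ≤ 2 * (R x - ρ) + 2 * (R y - ρ) := by
    intro x y
    linarith [mid x y, ρle ((2 : ℂ)⁻¹ • (x + y))]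
  have hx : ∀ n : ℕ, ∃ x, R x < ρ + 1 / (n + 1) := fun n =>
    exists_lt_of_ciInf_lt (lt_add_of_pos_right _ (by positivity))
  choose x hx using hx
  have cau : CauchySeq x := by
    refine cauchySeq_of_le_tendsto_0 (fun n : ℕ => Real.sqrt (4 * (1 / ((n : ℝ) + 1)))) ?_ ?_
    · intro n m N hn hm
      rw [dist_eq_norm]
      refine Real.le_sqrt_of_sq_le ((key _ _).trans ?_)
      have h1 : 1 / ((n : ℝ) + 1) ≤ 1 / ((N : ℝ) + 1) := by gcongr
      have h2 : 1 / ((m : ℝ) + 1) ≤ 1 / ((N : ℝ) + 1) := by gcongr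
      linarith [hx n, hx m]
    · have := (tendsto_one_div_add_atTop_nhds_zero_nat (𝕜 := ℝ)).const_mul 4
      rw [mul_zero] at this
      rw [← Real.sqrt_zero]
      exact (Real.continuous_sqrt.tendsto 0).comp this
  obtain ⟨c, hc⟩ := cauchySeq_tendsto_of_complete cau
  have Rc : R c ≤ ρ := by
    refine ciSup_le fun i => ?_
    have h1 : Tendsto (fun n => ‖x n - b i‖ ^ 2) atTop (𝓝 (‖c - b i‖ ^ 2)) :=
      ((hc.sub_const _).norm).pow 2
    have h2 : Tendsto (fun n : ℕ => ρ + 1 / ((n : ℝ) + 1)) atTop (𝓝 (ρ + 0)) :=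
      tendsto_const_nhds.add tendsto_one_div_add_atTop_nhds_zero_nat
    rw [add_zero] at h2
    exact le_of_tendsto_of_tendsto' h1 h2 fun n => (leR _ i).trans (hx n).le
  refine ⟨c, fun y hy => ?_⟩
  have Ry : R y ≤ R c := by
    refine ciSup_le fun i => ?_
    have := hy (Real.sqrt (R c)) (fun i => Real.le_sqrt_of_sq_le (leR c i)) i
    calc ‖y - b i‖ ^ 2 ≤ Real.sqrt (R c) ^ 2 := by gcongr
      _ = R c := Real.sq_sqrt (R0 c)
  have h := key y c
  have : ‖y - c‖ = 0 := by
    have : ‖y - c‖ ^ 2 ≤ 0 := by linarith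
    nlinarith [norm_nonneg (y - c)]
  exact sub_eq_zero.1 (norm_eq_zero.1 this)

variable [CompleteSpace H]

lemma norm_unitary_apply (U : unitary (H →L[ℂ] H)) (x : H) : ‖(U : H →L[ℂ] H) x‖ = ‖x‖ :=
  Unitary.norm_map U x

variable {G : Type u} [Group G]

/-- A bounded `1`-cocycle of a unitary representation is a coboundary. -/
lemma coboundary_of_bounded (π : G →* unitary (H →L[ℂ] H)) (b : G → H)
    (hb : ∀ s t, b (s * t) = b s + (π s : H →L[ℂ] H) (b t)) (hB : ∃ C, ∀ t, ‖b t‖ ≤ C) :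
    ∃ ξ : H, ∀ t, b t = ξ - (π t : H →L[ℂ] H) ξ := by
  obtain ⟨c, hc⟩ := exists_chebyshev_center b hB
  refine ⟨c, fun s => ?_⟩
  -- The isometry x ↦ π(s)x + b(s) sends b(s⁻¹t) to b(t). It permutes the family, so every radius
  -- valid for c is valid for the image of c.
  have h : (π s : H →L[ℂ] H) c + b s = c := by
    refine hc _ fun r hr t => ?_
    have e : (π s : H →L[ℂ] H) c + b s - b t = (π s : H →L[ℂ] H) (c - b (s⁻¹ * t)) := by
      have := hb s (s⁻¹ * t)
      rw [mul_inv_cancel_left] at this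
      rw [this, map_sub]; abel
    rw [e, norm_unitary_apply]
    exact hr _
  rw [eq_sub_iff_add_eq, add_comm]
  exact h

omit [CompleteSpace H] in
-- Inner products of linear combinations depend only on the Gram matrix. Hence matching two families
-- with equal Gram matrices is isometric on their spans.
lemma inner_linearCombination {ι : Type*} {E : Type*} [NormedAddCommGroup E]
    [InnerProductSpace ℂ E] {e : ι → H} {e' : ι → E}
    (h : ∀ i j, ⟪e' i, e' j⟫_ℂ = ⟪e i, e j⟫_ℂ) (x y : ι →₀ ℂ) :
    ⟪Finsupp.linearCombination ℂ e' x, Finsupp.linearCombination ℂ e' y⟫_ℂ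
      = ⟪Finsupp.linearCombination ℂ e x, Finsupp.linearCombination ℂ e y⟫_ℂ := by
  simp only [Finsupp.linearCombination_apply, Finsupp.sum_inner, Finsupp.inner_sum,
    inner_smul_left, inner_smul_right, h]

omit [CompleteSpace H] in
lemma denseRange_linearCombination {ι : Type*} {e : ι → H}
    (he : (Submodule.span ℂ (Set.range e)).topologicalClosure = ⊤) :
    DenseRange (Finsupp.linearCombination ℂ e) := by
  have : Set.range (Finsupp.linearCombination ℂ e) = (Submodule.span ℂ (Set.range e) : Set H) := by
    rw [← Finsupp.range_linearCombination]; rfl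
  rw [DenseRange, this]
  exact Submodule.dense_iff_topologicalClosure_eq_top.2 he

/-- A group acting on the index set of a total family and preserving its Gram matrix acts
unitarily on the Hilbert space. -/
lemma exists_unitary_rep {ι : Type*} (e : ι → H)
    (he : (Submodule.span ℂ (Set.range e)).topologicalClosure = ⊤) (a : G → ι → ι)
    (a1 : ∀ i, a 1 i = i) (am : ∀ s t i, a (s * t) i = a s (a t i))
    (ha : ∀ t i j, ⟪e (a t i), e (a t j)⟫_ℂ = ⟪e i, e j⟫_ℂ) :
    ∃ π : G →* unitary (H →L[ℂ] H), ∀ t i, (π t : H →L[ℂ] H) (e i) = e (a t i) := by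
  have hd := denseRange_linearCombination he
  let q : (ι →₀ ℂ) →ₗ[ℂ] H := Finsupp.linearCombination ℂ e
  let q' : G → (ι →₀ ℂ) →ₗ[ℂ] H := fun t => Finsupp.linearCombination ℂ fun i => e (a t i)
  have hn : ∀ t x, ‖q' t x‖ ≤ 1 * ‖q x‖ := by
    intro t x
    have := inner_linearCombination (e := e) (e' := fun i => e (a t i)) (ha t) x x
    rw [inner_self_eq_norm_sq_to_K, inner_self_eq_norm_sq_to_K] at this
    have h2 : ‖q' t x‖ ^ 2 = ‖q x‖ ^ 2 := by exact_mod_cast this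
    rw [one_mul]
    exact ((sq_eq_sq₀ (norm_nonneg _) (norm_nonneg _)).1 h2).le
  let U : G → H →L[ℂ] H := fun t => (q' t).extendOfNorm q
  have hU : ∀ t i, U t (e i) = e (a t i) := by
    intro t i
    have := LinearMap.extendOfNorm_eq (f := q' t) hd ⟨1, hn t⟩ (Finsupp.single i 1)
    simpa [q, q'] using this
  have ext : ∀ A B : H →L[ℂ] H, (∀ i, A (e i) = B (e i)) → A = B := by
    intro A B h
    refine ContinuousLinearMap.ext_on (s := Set.range e)
      (Submodule.dense_iff_topologicalClosure_eq_top.2 he) ?_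
    rintro _ ⟨i, rfl⟩
    exact h i
  have U1 : U 1 = 1 := ext _ _ fun i => by rw [hU, a1]; rfl
  have Um : ∀ s t, U (s * t) = U s * U t := fun s t => ext _ _ fun i => by
    rw [hU, am, mul_apply_eq_comp, hU, hU]
  -- On the total family ⟨e_i, e_{tj}⟩ = ⟨e_{t⁻¹i}, e_j⟩ by invariance of the Gram matrix. This
  -- gives unitarity with no separate proof of surjectivity.
  have adj : ∀ t, star (U t) = U t⁻¹ := by
    intro t
    refine ext _ _ fun i => ?_
    have h : innerSL ℂ (star (U t) (e i)) = innerSL ℂ (U t⁻¹ (e i)) := by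
      refine ContinuousLinearMap.ext_on (s := Set.range e)
        (Submodule.dense_iff_topologicalClosure_eq_top.2 he) ?_
      rintro _ ⟨j, rfl⟩
      rw [innerSL_apply_apply, innerSL_apply_apply, ContinuousLinearMap.star_eq_adjoint,
        ContinuousLinearMap.adjoint_inner_left, hU, hU,
        ← ha t (a t⁻¹ i) j, ← am, mul_inv_cancel, a1]
    exact (innerSL_inj (𝕜 := ℂ)).1 h
  refine ⟨⟨⟨fun t => ⟨U t, ?_⟩, Subtype.ext U1⟩, fun s t => Subtype.ext (Um s t)⟩, hU⟩
  rw [Unitary.mem_iff, adj]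
  constructor
  · rw [← Um, inv_mul_cancel, U1]
  · rw [← Um, mul_inv_cancel, U1]

end Hilbert

/-! ### Positive semidefinite kernels and the Gaussian kernel -/

section Kernels

open scoped ComplexOrder InnerProductSpace Matrix

/-- A positive semidefinite kernel is the Gram matrix of a total family in a Hilbert space. -/
lemma exists_gram_eq {X : Type v} (k : Matrix X X ℂ) (hk : k.PosSemidef) :
    ∃ (E : Type v) (_ : NormedAddCommGroup E) (_ : InnerProductSpace ℂ E) (_ : CompleteSpace E)
      (e : X → E), (∀ i j, ⟪e i, e j⟫_ℂ = k i j) ∧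
        (Submodule.span ℂ (Set.range e)).topologicalClosure = ⊤ := by
  -- Reproducing kernel spaces take operator-valued kernels, so the scalar k acts by multiplication
  -- on ℂ. The total family will be the kernel functions evaluated at 1.
  let K : Matrix X X (ℂ →L[ℂ] ℂ) := .of fun x y => k x y • ContinuousLinearMap.id ℂ ℂ
  have hh : ∀ i j, star (k j i) = k i j := fun i j => hk.1.apply i j
  have hK : K.PosSemidef := by
    refine (List.TFAE.out (RKHS.posSemidef_tfae (K := K)) 0 2 rfl rfl).2 ⟨?_, fun vv => ?_⟩
    · refine Matrix.IsHermitian.ext fun i j => ?_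
      simp only [K, Matrix.of_apply, star_smul, hh]
      congr 1
      exact star_one (ℂ →L[ℂ] ℂ)
    · have h := (Complex.nonneg_iff.1 (hk.2 vv)).1
      refine h.trans (le_of_eq ?_)
      change _ = Complex.re _
      congr 1
      refine Finsupp.sum_congr fun x _ => Finsupp.sum_congr fun x' _ => ?_
      have := hh x x'
      simp only [RCLike.star_def] at this
      simp [K, this]
      ring
  have : Fact K.PosSemidef := ⟨hK⟩
  let E := RKHS.OfKernel K
  refine ⟨E, inferInstance, inferInstance, inferInstance, fun x => RKHS.kerFun E x 1, ?_, ?_⟩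
  · intro i j
    rw [← RKHS.kernel_inner, RKHS.OfKernel.kernel_ofKernel]
    simp [K, ← hh i j]
  · rw [← RKHS.kerFun_dense E]
    congr 1
    refine le_antisymm (Submodule.span_mono ?_) (Submodule.span_le.2 ?_)
    · rintro _ ⟨x, rfl⟩
      exact ⟨x, 1, rfl⟩
    · rintro _ ⟨x, c, rfl⟩
      have : RKHS.kerFun E x c = c • RKHS.kerFun E x 1 := by rw [← map_smul]; simp
      rw [this]
      exact Submodule.smul_mem _ _ (Submodule.subset_span ⟨x, rfl⟩)

variable {X : Type*}

lemma posSemidef_of_tendsto {A : ℕ → Matrix X X ℂ} {B : Matrix X X ℂ}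
    (hA : ∀ n, (A n).PosSemidef) (h : ∀ i j, Tendsto (fun n => A n i j) atTop (𝓝 (B i j))) :
    B.PosSemidef := by
  refine ⟨Matrix.IsHermitian.ext fun i j => ?_, fun x => ?_⟩
  · refine tendsto_nhds_unique ((continuous_star.tendsto _).comp (h j i)) ((h i j).congr ?_)
    exact fun n => ((hA n).1.apply i j).symm
  · have : Tendsto (fun n => x.sum fun i xi => x.sum fun j xj => star xi * A n i j * xj) atTop
        (𝓝 (x.sum fun i xi => x.sum fun j xj => star xi * B i j * xj)) :=
      tendsto_finsetSum _ fun i _ => tendsto_finsetSum _ fun j _ =>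
        ((h i j).const_mul _).mul_const _
    exact ge_of_tendsto' this fun n => (hA n).2 x

lemma posSemidef_rank_one (d : X → ℂ) :
    (Matrix.of fun i j => star (d i) * d j : Matrix X X ℂ).PosSemidef := by
  refine ⟨Matrix.IsHermitian.ext fun i j => by simp [mul_comm], fun x => ?_⟩
  have : (x.sum fun i xi => x.sum fun j xj => star xi * (star (d i) * d j) * xj)
      = star (x.sum fun i xi => d i * xi) * x.sum fun i xi => d i * xi := by
    simp only [Finsupp.sum, star_sum, Finset.sum_mul_sum, star_mul']
    refine Finset.sum_congr rfl fun i _ => Finset.sum_congr rfl fun j _ => by ring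
  exact this ▸ star_mul_self_nonneg _

variable {H : Type*} [NormedAddCommGroup H] [InnerProductSpace ℂ H]

lemma posSemidef_inner (w : X → H) : (Matrix.of fun i j => ⟪w i, w j⟫_ℂ).PosSemidef := by
  refine ⟨Matrix.IsHermitian.ext fun i j => by simp, fun x => ?_⟩
  have : (x.sum fun i xi => x.sum fun j xj => star xi * ⟪w i, w j⟫_ℂ * xj)
      = ⟪Finsupp.linearCombination ℂ w x, Finsupp.linearCombination ℂ w x⟫_ℂ := by
    rw [Finsupp.linearCombination_apply, Finsupp.sum, Finsupp.sum, sum_inner]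
    refine Finset.sum_congr rfl fun i _ => ?_
    rw [inner_sum]
    refine Finset.sum_congr rfl fun j _ => ?_
    rw [inner_smul_left, inner_smul_right, RCLike.star_def]; ring
  refine le_of_le_of_eq ?_ this.symm
  rw [inner_self_eq_norm_sq_to_K]
  exact pow_nonneg (RCLike.ofReal_nonneg.2 (norm_nonneg _)) 2

/-- By the Schur product theorem the entrywise powers are positive. The Taylor coefficients of exp
are nonnegative, and positivity passes to entrywise limits. -/
lemma posSemidef_exp {A : Matrix X X ℂ} (hA : A.PosSemidef) :
    (Matrix.of fun i j => Complex.exp (A i j)).PosSemidef := by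
  have hp : ∀ n : ℕ, (Matrix.of fun i j => A i j ^ n).PosSemidef := by
    intro n
    induction n with
    | zero => simpa using posSemidef_rank_one (X := X) fun _ => (1 : ℂ)
    | succ n ih =>
      have := ih.hadamard hA
      refine (congrArg _ ?_).mp this
      ext i j
      simp [pow_succ]
  have hs : ∀ n : ℕ, (∑ m ∈ Finset.range n,
      ((m.factorial : ℂ)⁻¹) • (Matrix.of fun i j => A i j ^ m : Matrix X X ℂ)).PosSemidef := by
    refine fun n => Matrix.posSemidef_sum _ fun m _ => (hp m).smul ?_
    have : (0 : ℝ) ≤ (m.factorial : ℝ)⁻¹ := by positivity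
    have := Complex.zero_le_real.2 this
    push_cast at this
    exact this
  refine posSemidef_of_tendsto hs fun i j => ?_
  have := (NormedSpace.expSeries_div_hasSum_exp (A i j)).tendsto_sum_nat
  rw [← Complex.exp_eq_exp_ℂ] at this
  refine this.congr fun n => ?_
  rw [Matrix.sum_apply]
  refine Finset.sum_congr rfl fun m _ => ?_
  simp [div_eq_inv_mul]

/-- Expanding the square gives exp(-‖w_i - w_j‖²) = exp⟨w_i, w_j⟩ · exp⟨w_j, w_i⟩ · exp(-‖w_i‖²)
exp(-‖w_j‖²). This is a Schur product of an entrywise exponential, its transpose and a rank one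
kernel. -/
lemma posSemidef_gaussian (w : X → H) :
    (Matrix.of fun i j => (Real.exp (-‖w i - w j‖ ^ 2) : ℂ)).PosSemidef := by
  have h1 := posSemidef_exp (posSemidef_inner w)
  have h2 := (h1.hadamard h1.transpose).hadamard
    (posSemidef_rank_one fun i => (Real.exp (-‖w i‖ ^ 2) : ℂ))
  refine (congrArg _ ?_).mp h2
  ext i j
  have e : ⟪w i, w j⟫_ℂ + ⟪w j, w i⟫_ℂ = ((2 * RCLike.re ⟪w i, w j⟫_ℂ : ℝ) : ℂ) := by
    rw [← inner_conj_symm (w j) (w i)]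
    exact Complex.add_conj _
  have e2 : -‖w i - w j‖ ^ 2
      = 2 * RCLike.re ⟪w i, w j⟫_ℂ + (-‖w i‖ ^ 2) + (-‖w j‖ ^ 2) := by
    rw [norm_sub_sq (𝕜 := ℂ)]; ring
  simp only [Matrix.hadamard_apply, Matrix.of_apply, Matrix.transpose_apply]
  rw [← Complex.exp_add, e, e2, Real.exp_add, Real.exp_add, RCLike.star_def, Complex.conj_ofReal]
  push_cast
  ring

end Kernels

/-! ### Delorme's theorem: property (T) makes cocycles coboundaries -/

section Delorme

open scoped ComplexOrder InnerProductSpace Matrix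

variable {H : Type v} [NormedAddCommGroup H] [InnerProductSpace ℂ H]

/-- For uniformly bounded functionals, pointwise convergence on a total family passes to its span by
linearity and to the closure by an ε/2 argument. -/
lemma tendsto_zero_of_total {ι : Type*} {e : ι → H}
    (he : (Submodule.span ℂ (Set.range e)).topologicalClosure = ⊤) (A : ℕ → H →L[ℂ] ℂ) {C : ℝ}
    (hC : ∀ n, ‖A n‖ ≤ C) (h : ∀ i, Tendsto (fun n => A n (e i)) atTop (𝓝 0)) (x : H) :
    Tendsto (fun n => A n x) atTop (𝓝 0) := by
  have hs : ∀ z ∈ Submodule.span ℂ (Set.range e), Tendsto (fun n => A n z) atTop (𝓝 0) := by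
    intro z hz
    induction hz using Submodule.span_induction with
    | mem z hz => obtain ⟨i, rfl⟩ := hz; exact h i
    | zero => simp
    | add y z _ _ hy hz => simpa using hy.add hz
    | smul c y _ hy => simpa using hy.const_mul c
  have C0 : 0 ≤ C := (norm_nonneg _).trans (hC 0)
  rw [Metric.tendsto_atTop]
  intro ε hε
  obtain ⟨z, hz, hxz⟩ := Metric.dense_iff.1
    (Submodule.dense_iff_topologicalClosure_eq_top.2 he) x (ε / (2 * (C + 1))) (by positivity)
  obtain ⟨N, hN⟩ := Metric.tendsto_atTop.1 (hs z hxz) (ε / 2) (by positivity)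
  refine ⟨N, fun n hn => ?_⟩
  have h1 := hN n hn
  rw [dist_zero_right] at h1 ⊢
  rw [Metric.mem_ball, dist_eq_norm, norm_sub_rev] at hz
  have h2 : ‖A n (x - z)‖ ≤ (C + 1) * (ε / (2 * (C + 1))) := by
    refine ((A n).le_opNorm _).trans ?_
    gcongr
    exact (hC n).trans (by linarith)
  have e1 : (C + 1) * (ε / (2 * (C + 1))) = ε / 2 := by field_simp
  calc ‖A n x‖ = ‖A n (x - z) + A n z‖ := by rw [map_sub]; congr 1; ring
    _ ≤ ‖A n (x - z)‖ + ‖A n z‖ := norm_add_le _ _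
    _ < ε := by linarith

variable [CompleteSpace H] {G : Type u} [Group G] [TopologicalSpace G]

/-- The operators have norm at most 1, so continuity of orbit maps passes from the span of a total
family to its closure by an ε/3 argument. -/
lemma isContRep_of_total (π : G →* unitary (H →L[ℂ] H)) {ι : Type*} {e : ι → H}
    (he : (Submodule.span ℂ (Set.range e)).topologicalClosure = ⊤)
    (h : ∀ i, Continuous fun t => (π t : H →L[ℂ] H) (e i)) : IsContRep π := by
  have hs : ∀ z ∈ Submodule.span ℂ (Set.range e),
      Continuous fun t => (π t : H →L[ℂ] H) z := by
    intro z hz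
    induction hz using Submodule.span_induction with
    | mem z hz => obtain ⟨i, rfl⟩ := hz; exact h i
    | zero => simpa using continuous_const
    | add y z _ _ hy hz => simp only [map_add]; exact hy.add hz
    | smul c y _ hy => simp only [map_smul]; exact hy.const_smul c
  intro x
  refine Metric.continuous_iff'.2 fun t ε hε => ?_
  obtain ⟨z, hz, hxz⟩ := Metric.dense_iff.1
    (Submodule.dense_iff_topologicalClosure_eq_top.2 he) x (ε / 3) (by positivity)
  rw [Metric.mem_ball, dist_eq_norm, norm_sub_rev] at hz
  filter_upwards [Metric.continuous_iff'.1 (hs z hxz) t (ε / 3) (by positivity)] with s h1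
  rw [dist_eq_norm] at h1 ⊢
  calc ‖(π s : H →L[ℂ] H) x - (π t : H →L[ℂ] H) x‖
      = ‖(π s : H →L[ℂ] H) (x - z) - (π t : H →L[ℂ] H) (x - z)
          + ((π s : H →L[ℂ] H) z - (π t : H →L[ℂ] H) z)‖ := by
        rw [map_sub, map_sub]; congr 1; abel
    _ ≤ ‖(π s : H →L[ℂ] H) (x - z)‖ + ‖(π t : H →L[ℂ] H) (x - z)‖
          + ‖(π s : H →L[ℂ] H) z - (π t : H →L[ℂ] H) z‖ :=
        (norm_add_le _ _).trans (by gcongr; exact norm_sub_le _ _)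
    _ < ε := by
        rw [norm_unitary_apply, norm_unitary_apply]
        linarith

/-- The Delorme theorem: for a group with property `(T)`, every continuous `1`-cocycle of a
unitary representation is a coboundary. -/
lemma coboundary_of_propertyT (hT : PropertyT.{u, v} G) (π : G →* unitary (H →L[ℂ] H))
    (b : G → H) (hb : ∀ s t, b (s * t) = b s + (π s : H →L[ℂ] H) (b t))
    (hπ : IsContRep π) (cb : Continuous b) :
    ∃ ξ : H, ∀ t, b t = ξ - (π t : H →L[ℂ] H) ξ := by
  refine coboundary_of_bounded π b hb ?_
  by_contra! hunb
  choose g hg using fun n : ℕ => hunb n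
  have b1 : b 1 = 0 := by simpa using hb 1 1
  -- Inverse widths of the Gaussians: positive, so that each layer still sees b tend to infinity,
  -- and tending to 0, so that the layers become almost invariant.
  let s : ℕ → ℝ := fun n => 1 / ((n : ℝ) + 1)
  have s0 : ∀ n, 0 < s n := fun n => by positivity
  -- The identity kernel on ℕ, multiplied entrywise with the Gaussian, makes layers with different n
  -- orthogonal. All widths then sit in one representation, as the definition of property (T)
  -- requires.
  have hk := ((Matrix.PosSemidef.one (n := ℕ) (R := ℂ)).submatrix
    (Prod.fst : ℕ × H → ℕ)).hadamard (posSemidef_gaussian fun i : ℕ × H => (s i.1 : ℂ) • i.2)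
  obtain ⟨E, _, _, _, e, heg, he⟩ := exists_gram_eq _ hk
  have gram : ∀ n m v w, ⟪e (n, v), e (m, w)⟫_ℂ
      = if n = m then (Real.exp (-(s n ^ 2 * ‖v - w‖ ^ 2)) : ℂ) else 0 := by
    intro n m v w
    rw [heg]
    by_cases h : n = m
    · subst h
      simp only [Matrix.hadamard_apply, Matrix.submatrix_apply, Matrix.one_apply_eq, one_mul,
        Matrix.of_apply, if_true]
      rw [← smul_sub, norm_smul, Complex.norm_real, mul_pow, Real.norm_eq_abs, sq_abs]
    · simp [Matrix.hadamard_apply, h]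
  have nrm : ∀ n v w, ‖e (n, v) - e (n, w)‖ ^ 2
      = 2 - 2 * Real.exp (-(s n ^ 2 * ‖v - w‖ ^ 2)) := by
    intro n v w
    have h1 : ∀ v, ‖e (n, v)‖ ^ 2 = 1 := fun v => by
      rw [← inner_self_eq_norm_sq (𝕜 := ℂ), gram]; simp
    rw [norm_sub_sq (𝕜 := ℂ), h1, h1, gram, if_pos rfl]
    simp only [RCLike.re_eq_complex_re, Complex.ofReal_re]
    ring
  -- The affine action v ↦ π(t)v + b(t) preserves distances in each layer, hence the Gram matrix.
  obtain ⟨ρ, hρ⟩ := exists_unitary_rep (G := G) e he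
    (fun t i => (i.1, (π t : H →L[ℂ] H) i.2 + b t)) (by rintro ⟨n, v⟩; simp [b1])
    (by
      rintro t₁ t₂ ⟨n, v⟩
      simp only [map_mul, hb, map_add, Submonoid.coe_mul, mul_apply_eq_comp]
      congr 1; abel)
    (by
      rintro t ⟨n, v⟩ ⟨m, w⟩
      simp only [gram]
      rw [add_sub_add_right_eq_sub, ← map_sub, norm_unitary_apply])
  have ce : ∀ n, Continuous fun v : H => e (n, v) := by
    refine fun n => continuous_iff_continuousAt.2 fun v => ?_
    rw [ContinuousAt, tendsto_iff_norm_sub_tendsto_zero]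
    have h : Tendsto (fun w : H => ‖e (n, w) - e (n, v)‖ ^ 2) (𝓝 v) (𝓝 0) := by
      simp only [nrm]
      have : Continuous fun w : H => 2 - 2 * Real.exp (-(s n ^ 2 * ‖w - v‖ ^ 2)) := by fun_prop
      simpa using this.tendsto v
    simpa [Function.comp_def, Real.sqrt_sq] using (Real.continuous_sqrt.tendsto 0).comp h
  have cρ : IsContRep ρ := by
    refine isContRep_of_total ρ he ?_
    rintro ⟨n, v⟩
    simp only [hρ]
    exact (ce n).comp ((hπ v).add cb)
  obtain ⟨ξ, ξ0, hξ⟩ := hT E ρ cρ (by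
    intro K hK δ hδ
    obtain ⟨C, hC⟩ := hK.exists_bound_of_continuousOn cb.continuousOn
    -- Since ρ(t) e(n, 0) = e(n, b(t)), this expression bounds the squared displacement of e(n, 0)
    -- for every t in K, where ‖b‖ ≤ C.
    have hlim : Tendsto (fun n => 2 - 2 * Real.exp (-(s n ^ 2 * C ^ 2))) atTop (𝓝 0) := by
      have h1 : Tendsto s atTop (𝓝 0) := tendsto_one_div_add_atTop_nhds_zero_nat
      have h2 : Continuous fun r : ℝ => 2 - 2 * Real.exp (-(r ^ 2 * C ^ 2)) := by fun_prop
      simpa [Function.comp_def] using (h2.tendsto 0).comp h1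
    obtain ⟨n, hn⟩ := (hlim.eventually (gt_mem_nhds (pow_pos hδ 2))).exists
    refine ⟨e (n, 0), ?_, fun t ht => ?_⟩
    · have : ‖e (n, 0)‖ ^ 2 = 1 := by
        rw [← inner_self_eq_norm_sq (𝕜 := ℂ), gram]; simp
      exact (pow_eq_one_iff_of_nonneg (norm_nonneg _) two_ne_zero).1 this
    · refine lt_of_pow_lt_pow_left₀ 2 hδ.le (lt_of_le_of_lt ?_ hn)
      rw [hρ, nrm]
      have h3 : ‖(π t : H →L[ℂ] H) 0 + b t - 0‖ ≤ C := by simpa using hC t ht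
      gcongr)
  refine ξ0 ?_
  have hz : ∀ i, ⟪ξ, e i⟫_ℂ = 0 := by
    rintro ⟨n, v⟩
    -- The vectors ρ(g_k) e(n, v) tend weakly to 0 because ‖b(g_k)‖ → ∞, whereas their pairing with
    -- the invariant ξ does not depend on k. So ξ is orthogonal to a total family.
    have h := tendsto_zero_of_total he (fun k => innerSL ℂ ((ρ (g k) : E →L[ℂ] E) (e (n, v))))
      (C := ‖e (n, v)‖) (fun k => by rw [innerSL_apply_norm, norm_unitary_apply]) ?_ ξ
    · have h2 : ∀ k, innerSL ℂ ((ρ (g k) : E →L[ℂ] E) (e (n, v))) ξ = ⟪e (n, v), ξ⟫_ℂ := by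
        intro k
        rw [innerSL_apply_apply]
        conv_lhs => rw [← hξ (g k)]
        exact Unitary.inner_map_map _ _ _
      simp only [h2] at h
      rw [← inner_conj_symm, tendsto_nhds_unique tendsto_const_nhds h, map_zero]
    · rintro ⟨m, w⟩
      simp only [innerSL_apply_apply, hρ, gram]
      split_ifs
      · have h3 : Tendsto (fun k => ‖(π (g k) : H →L[ℂ] H) v + b (g k) - w‖) atTop atTop := by
          refine tendsto_atTop_mono (f := fun k : ℕ => (k : ℝ) - (‖v‖ + ‖w‖)) (fun k => ?_)
            (tendsto_atTop_add_const_right _ _ tendsto_natCast_atTop_atTop)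
          have h4 : b (g k) = ((π (g k) : H →L[ℂ] H) v + b (g k) - w)
              - (π (g k) : H →L[ℂ] H) v + w := by abel
          have h5 := (norm_add_le (((π (g k) : H →L[ℂ] H) v + b (g k) - w)
              - (π (g k) : H →L[ℂ] H) v) w).trans (add_le_add_left (norm_sub_le _ _) _)
          rw [← h4, norm_unitary_apply] at h5
          linarith [hg k]
        have h6 : Tendsto (fun k => Real.exp (-(s n ^ 2 *
            ‖(π (g k) : H →L[ℂ] H) v + b (g k) - w‖ ^ 2))) atTop (𝓝 0) :=
          Real.tendsto_exp_neg_atTop_nhds_zero.comp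
            (((tendsto_pow_atTop two_ne_zero).comp h3).const_mul_atTop (pow_pos (s0 n) 2))
        exact_mod_cast (Complex.continuous_ofReal.tendsto 0).comp h6
      · exact tendsto_const_nhds
  have hA : innerSL ℂ ξ = 0 := by
    refine ContinuousLinearMap.ext_on (s := Set.range e)
      (Submodule.dense_iff_topologicalClosure_eq_top.2 he) ?_
    rintro _ ⟨i, rfl⟩
    exact hz i
  exact (innerSL_inj (𝕜 := ℂ)).1 (hA.trans (map_zero _).symm)

end Delorme

/-! ### The inductive limit topology on `C_c(G)`, translations and convolution -/

section CcTopology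

open scoped CompactlySupported BoundedContinuousFunction

variable {G : Type*} [Group G] [TopologicalSpace G] [IsTopologicalGroup G]
  [LocallyCompactSpace G] [MeasurableSpace G] [BorelSpace G]
  {μ : Measure G}

namespace CcG

/-- An element of `C_c(G)` from a continuous function with compact support. -/
def of (f : G → ℂ) (cf : Continuous f) (hf : HasCompactSupport f) : CcG μ :=
  (⟨⟨f, cf⟩, hf⟩ : C_c(G, ℂ))

@[simp] lemma of_apply (f : G → ℂ) (cf : Continuous f) (hf : HasCompactSupport f) (t : G) :
    (of f cf hf : CcG μ) t = f t := rfl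

@[simp] lemma sub_apply (f g : CcG μ) (t : G) : (f - g) t = f t - g t := rfl

variable [μ.IsHaarMeasure]

lemma norm_toL1 (f : CcG μ) : ‖Integrable.toL1 f f.integrable‖ = ∫ t, ‖f t‖ ∂μ :=
  L1.norm_of_fun_eq_integral_norm _

variable {F : Type*} [NormedAddCommGroup F] [NormedSpace ℂ F]

variable (μ) in
/-- The space `C_K(G)`, to be given the `L¹`-norm. -/
def CK (K : Set G) : Type _ := supportedIn μ K

instance (K : Set G) : AddCommGroup (CK μ K) := inferInstanceAs (AddCommGroup (supportedIn μ K))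
instance (K : Set G) : Module ℂ (CK μ K) := inferInstanceAs (Module ℂ (supportedIn μ K))

/-- The map `C_K(G) → L¹(G)`. -/
def CK.toL1 (K : Set G) : CK μ K →ₗ[ℂ] Lp ℂ 1 μ where
  toFun f := Integrable.toL1 (f.1 : CcG μ) (integrable f.1)
  map_add' f g := Integrable.toL1_add _ _ (integrable f.1) (integrable g.1)
  map_smul' c f := Integrable.toL1_smul _ (integrable f.1) c

instance (K : Set G) : SeminormedAddCommGroup (CK μ K) :=
  SeminormedAddCommGroup.induced _ _ (CK.toL1 K)

instance (K : Set G) : NormedSpace ℂ (CK μ K) := NormedSpace.induced ℂ _ _ (CK.toL1 K)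

lemma CK.norm_def {K : Set G} (f : CK μ K) : ‖f‖ = ∫ t, ‖(f.1 : CcG μ) t‖ ∂μ := norm_toL1 f.1

/-- The inclusion `C_K(G) → C_c(G)`. -/
def CK.incl (K : Set G) : CK μ K →ₗ[ℂ] CcG μ := (supportedIn μ K).subtype

lemma CK.continuous_incl {K : Set G} (hK : IsCompact K) : Continuous (CK.incl (μ := μ) K) :=
  continuous_sInf_rng.2 fun _ hT => hT.1 K hK

/-- With `continuous_of_bound` this characterises 𝔗-continuity of linear maps into a normed space by
L¹-bounds on each C_K(G); the definition of 𝔗 is not unfolded afterwards. -/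
lemma bound_of_continuous (T : CcG μ →ₗ[ℂ] F) (hT : Continuous T) {K : Set G} (hK : IsCompact K) :
    ∃ C, 0 ≤ C ∧ ∀ f : CcG μ, tsupport f ⊆ K → ‖T f‖ ≤ C * ∫ t, ‖f t‖ ∂μ := by
  let A : CK μ K →L[ℂ] F := ⟨T ∘ₗ CK.incl K, hT.comp (CK.continuous_incl hK)⟩
  refine ⟨‖A‖, norm_nonneg _, fun f hf => ?_⟩
  let e : CK μ K := (⟨f, hf⟩ : supportedIn μ K)
  have h := A.le_opNorm e
  rw [CK.norm_def] at h
  exact h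

/-- The topology pulled back along T is one of the locally convex topologies competing in the
definition of 𝔗, and 𝔗 is finer than all of them. -/
lemma continuous_of_bound (T : CcG μ →ₗ[ℂ] F)
    (h : ∀ K : Set G, IsCompact K → ∃ C, ∀ f : CcG μ, tsupport f ⊆ K →
      ‖T f‖ ≤ C * ∫ t, ‖f t‖ ∂μ) : Continuous T := by
  refine continuous_sInf_dom (t := TopologicalSpace.induced T inferInstance) ⟨?_, ?_, ?_, ?_⟩
    continuous_induced_dom
  · intro K hK
    obtain ⟨C, hC⟩ := h K hK
    refine continuous_induced_rng.2 ?_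
    have : Continuous (T ∘ₗ CK.incl K) :=
      AddMonoidHomClass.continuous_of_bound (T ∘ₗ CK.incl K) C fun f =>
        (hC f.1 f.2).trans (le_of_eq (by rw [CK.norm_def]))
    exact this
  · exact topologicalAddGroup_induced T
  · exact continuousSMul_induced T
  · exact LocallyConvexSpace.induced (T.restrictScalars ℝ)

/-- Left translation `(λ_t f)(s) = f(t⁻¹ s)`. -/
def translate (t : G) : CcG μ →ₗ[ℂ] CcG μ where
  toFun f := of (fun s => f (t⁻¹ * s)) (f.continuous.comp (continuous_const_mul _))
    (f.hasCompactSupport.comp_homeomorph (Homeomorph.mulLeft t⁻¹))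
  map_add' _ _ := rfl
  map_smul' _ _ := rfl

@[simp] lemma translate_apply (t : G) (f : CcG μ) (s : G) : translate t f s = f (t⁻¹ * s) := rfl

lemma translate_one (f : CcG μ) : translate 1 f = f := by ext; simp

lemma translate_mul (s t : G) (f : CcG μ) : translate (s * t) f = translate s (translate t f) := by
  ext; simp [mul_assoc]

lemma integral_translate (t : G) (f : CcG μ) : ∫ s, translate t f s ∂μ = ∫ s, f s ∂μ :=
  integral_mul_left_eq_self _ _

lemma integral_norm_translate (t : G) (f : CcG μ) :
    ∫ s, ‖translate t f s‖ ∂μ = ∫ s, ‖f s‖ ∂μ :=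
  integral_mul_left_eq_self (fun s => ‖f s‖) _

/-- The value (f^* ∗ g)(r) is the integral of conj f(s) · g(sr) against Δ(s) ds⁻¹, which is left
invariant, so a common left translation cancels. It makes translation unitary on vectors Φ(f)x, as
⟨Φ(f)x, Φ(g)z⟩ = ⟨x, Φ(f^* ∗ g)z⟩. -/
lemma star_translate_mul_translate [μ.Regular] (t : G) (f g : CcG μ) :
    star (translate t f) * translate t g = star f * g := by
  ext r
  have key : ∀ f g : CcG μ, (star f * g) r
      = ∫ s, star (f s) * g (s * r) ∂(flipMeasure μ) := by
    intro f g
    rw [integral_flip, mul_apply]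
    simp only [star_apply, Complex.real_smul, mul_assoc]
  rw [key, key]
  have h := integral_mul_left_eq_self (μ := flipMeasure μ) (fun s => star (f s) * g (s * r)) t⁻¹
  simpa [mul_assoc] using h

variable [T2Space G]

lemma tsupport_subset {f : G → ℂ} {K : Set G} (hK : IsCompact K) (h : ∀ t ∉ K, f t = 0) :
    tsupport f ⊆ K :=
  closure_minimal (fun _ ht => by_contra fun hK => ht (h _ hK)) hK.isClosed

lemma tsupport_translate_subset {K : Set G} (hK : IsCompact K) {t : G} (ht : t ∈ K) (g : CcG μ) :
    tsupport (translate t g) ⊆ K * tsupport g := by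
  refine tsupport_subset (hK.mul g.hasCompactSupport) fun s hs => ?_
  exact image_eq_zero_of_notMem_tsupport (f := g) fun h => hs
    (Set.mem_mul.2 ⟨t, ht, t⁻¹ * s, h, by simp⟩)

/-- For t in a compact neighbourhood N all translates live in the single C_K(G) with K = N · supp g.
There T is L¹-bounded, and translation is L¹-continuous. -/
lemma continuous_translate (T : CcG μ →ₗ[ℂ] F) (hT : Continuous T) (g : CcG μ) :
    Continuous fun t => T (translate t g) := by
  refine continuous_iff_continuousAt.2 fun t₀ => ?_
  obtain ⟨N, hN, ht⟩ := exists_compact_mem_nhds t₀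
  obtain ⟨C, -, hC⟩ := bound_of_continuous T hT (hN.mul g.hasCompactSupport)
  have h1 : ContinuousOn (fun t => ∫ s, ‖g (t⁻¹ * s) - g (t₀⁻¹ * s)‖ ∂μ) N := by
    refine continuousOn_integral_of_compact_support (hN.mul g.hasCompactSupport) ?_ ?_
    · have := g.continuous
      exact Continuous.continuousOn (by fun_prop)
    · intro t s ht' hs
      have h2 : ∀ t ∈ N, g (t⁻¹ * s) = 0 := fun t ht' => image_eq_zero_of_notMem_tsupport fun h =>
        hs (Set.mem_mul.2 ⟨t, ht', t⁻¹ * s, h, by simp⟩)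
      rw [h2 t ht', h2 t₀ (mem_of_mem_nhds ht), sub_zero, norm_zero]
  have h2 := (h1.continuousAt ht).tendsto.const_mul C
  simp only [sub_self, norm_zero, integral_zero, mul_zero] at h2
  rw [ContinuousAt, tendsto_iff_norm_sub_tendsto_zero]
  refine squeeze_zero' (Eventually.of_forall fun _ => norm_nonneg _) ?_ h2
  filter_upwards [ht] with t ht'
  rw [← map_sub]
  exact hC _ ((tsupport_sub _ _).trans (Set.union_subset (tsupport_translate_subset hN ht' g)
    (tsupport_translate_subset hN (mem_of_mem_nhds ht) g)))

/-- The Banach space of continuous functions vanishing outside of `K`. -/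
def boundedOn (K : Set G) : Submodule ℂ (G →ᵇ ℂ) where
  carrier := {f | ∀ t ∉ K, f t = 0}
  zero_mem' _ _ := rfl
  add_mem' {f g} hf hg t ht := by simp [hf t ht, hg t ht]
  smul_mem' c f hf t ht := by simp [hf t ht]

omit [Group G] [IsTopologicalGroup G] [LocallyCompactSpace G] [MeasurableSpace G]
  [BorelSpace G] [T2Space G] in
lemma isClosed_boundedOn (K : Set G) : IsClosed (boundedOn K : Set (G →ᵇ ℂ)) := by
  have : (boundedOn K : Set (G →ᵇ ℂ)) = ⋂ t ∈ Kᶜ, {f | f t = 0} := by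
    ext; simp only [Set.mem_iInter]; rfl
  rw [this]
  exact isClosed_biInter fun t _ => isClosed_eq (continuous_eval_const t)
    continuous_const

/-- A continuous linear map on `C_c(G)` exchanges with the integral that defines `f ∗ g`. -/
lemma map_mul_eq_integral [CompleteSpace F] (T : CcG μ →ₗ[ℂ] F) (hT : Continuous T)
    (f g : CcG μ) : T (f * g) = ∫ t, f t • T (translate t g) ∂μ := by
  -- The vector-valued integral needs a complete space. It is taken among the bounded continuous
  -- functions vanishing off K, where T is bounded because ‖·‖₁ ≤ μ(K) ‖·‖_∞.
  let K : Set G := tsupport f * tsupport g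
  have hK : IsCompact K := IsCompact.mul f.hasCompactSupport g.hasCompactSupport
  have hz : ∀ t, ∀ s ∉ K, f t * g (t⁻¹ * s) = 0 := by
    intro t s hs
    by_cases h1 : t ∈ tsupport f
    · have h2 : t⁻¹ * s ∉ tsupport g := fun h2 => hs (Set.mem_mul.2 ⟨t, h1, t⁻¹ * s, h2, by simp⟩)
      simp [image_eq_zero_of_notMem_tsupport h2]
    · simp [image_eq_zero_of_notMem_tsupport h1]
  let E := boundedOn (G := G) K
  have : CompleteSpace E := (isClosed_boundedOn K).completeSpace_coe
  obtain ⟨C, C0, hC⟩ := bound_of_continuous T hT hK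
  have hs : ∀ e : E, HasCompactSupport (e : G →ᵇ ℂ) := fun e => HasCompactSupport.intro hK e.2
  let toCc : E →ₗ[ℂ] CcG μ :=
    { toFun := fun e => of e (e : G →ᵇ ℂ).continuous (hs e)
      map_add' := fun _ _ => rfl
      map_smul' := fun _ _ => rfl }
  let S : E →L[ℂ] F := (T ∘ₗ toCc).mkContinuous (C * μ.real K) fun e => by
    refine (hC (toCc e) (tsupport_subset hK e.2)).trans ?_
    rw [mul_assoc]
    refine mul_le_mul_of_nonneg_left ?_ C0
    have h1 : ∫ t, ‖toCc e t‖ ∂μ = ∫ t in K, ‖toCc e t‖ ∂μ :=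
      (setIntegral_eq_integral_of_forall_compl_eq_zero fun t ht => by
        rw [norm_eq_zero]; exact e.2 t ht).symm
    rw [h1]
    refine (Real.le_norm_self _).trans ((norm_setIntegral_le_of_norm_le_const
      hK.measure_lt_top fun t _ => ?_).trans (le_of_eq (mul_comm ‖e‖ _)))
    rw [norm_norm]
    exact (e : G →ᵇ ℂ).norm_coe_le_norm t
  have cg : Continuous fun p : G × G => f p.1 * g (p.1⁻¹ * p.2) := by
    have := f.continuous
    have := g.continuous
    fun_prop
  have cpt : ∀ t, HasCompactSupport fun s => f t * g (t⁻¹ * s) := fun t =>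
    HasCompactSupport.intro hK (hz t)
  let h : G → E := fun t => ⟨BoundedContinuousFunction.ofNormedAddCommGroup
    (fun s => f t * g (t⁻¹ * s)) (cg.comp (Continuous.prodMk_right t))
    ((cpt t).exists_bound_of_continuous (cg.comp (Continuous.prodMk_right t))).choose
    ((cpt t).exists_bound_of_continuous (cg.comp (Continuous.prodMk_right t))).choose_spec,
    hz t⟩
  have hh : ∀ t s, (h t : G →ᵇ ℂ) s = f t * g (t⁻¹ * s) := fun _ _ => rfl
  -- Currying a jointly continuous function on G × K with K compact gives continuity in the uniform
  -- norm; off K all the functions vanish.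
  have ch : Continuous h := by
    have : CompactSpace K := isCompact_iff_compactSpace.1 hK
    let c : C(G, C(K, ℂ)) := ContinuousMap.curry ⟨fun p => f p.1 * g (p.1⁻¹ * (p.2 : G)),
      cg.comp (continuous_fst.prodMk (continuous_subtype_val.comp continuous_snd))⟩
    refine continuous_iff_continuousAt.2 fun t₀ => ?_
    have h1 := tendsto_iff_norm_sub_tendsto_zero.1 (c.continuous.tendsto t₀)
    refine tendsto_iff_norm_sub_tendsto_zero.2 (squeeze_zero (fun _ => norm_nonneg _)
      (fun t => ?_) h1)
    refine (BoundedContinuousFunction.norm_le (norm_nonneg _)).2 fun s => ?_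
    by_cases hs : s ∈ K
    · exact (c t - c t₀).norm_coe_le_norm ⟨s, hs⟩
    · change ‖f t * g (t⁻¹ * s) - f t₀ * g (t₀⁻¹ * s)‖ ≤ _
      rw [hz t s hs, hz t₀ s hs]; simp
  have hi : Integrable h μ := by
    refine ch.integrable_of_hasCompactSupport (HasCompactSupport.intro f.hasCompactSupport ?_)
    intro t ht
    ext s
    change f t * g (t⁻¹ * s) = 0
    rw [image_eq_zero_of_notMem_tsupport ht, zero_mul]
  have e1 : toCc (∫ t, h t ∂μ) = f * g := by
    ext s
    have := (BoundedContinuousFunction.evalCLM ℂ s ∘L E.subtypeL).integral_comp_comm hi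
    rw [mul_apply]
    exact this.symm
  have e2 := S.integral_comp_comm hi
  have e3 : S (∫ t, h t ∂μ) = T (toCc (∫ t, h t ∂μ)) := rfl
  rw [← e1, ← e3, ← e2]
  refine integral_congr_ae (Eventually.of_forall fun t => ?_)
  change T (toCc (h t)) = f t • T (translate t g)
  rw [← map_smul]
  rfl

end CcG

end CcTopology

/-! ### Integrated forms of unitary representations -/

section IntegratedForm

open scoped InnerProductSpace

variable {G : Type u} [Group G] [TopologicalSpace G] [IsTopologicalGroup G]
  [LocallyCompactSpace G] [MeasurableSpace G] [BorelSpace G]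
  {μ : Measure G} [μ.IsHaarMeasure]
  {H : Type v} [NormedAddCommGroup H] [InnerProductSpace ℂ H] [CompleteSpace H]

namespace CcG

lemma continuous_smul {F : Type*} [NormedAddCommGroup F] [NormedSpace ℂ F] (f : CcG μ) {h : G → F}
    (hh : Continuous h) : Continuous fun t => f t • h t := f.continuous.smul hh

lemma integrable_smul {F : Type*} [NormedAddCommGroup F] [NormedSpace ℂ F] (f : CcG μ) {h : G → F}
    (hh : Continuous h) : Integrable (fun t => f t • h t) μ :=
  (f.continuous_smul hh).integrable_of_hasCompactSupport f.hasCompactSupport.smul_right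

lemma exists_integral_eq_one : ∃ g : CcG μ, ∫ t, g t ∂μ = 1 := by
  obtain ⟨f, f_comp, f_nonneg, f_one⟩ :
    ∃ f : C(G, ℝ), HasCompactSupport f ∧ 0 ≤ f ∧ f 1 ≠ 0 := exists_continuous_nonneg_pos 1
  have hpos : 0 < ∫ x, f x ∂μ :=
    f.continuous.integral_pos_of_hasCompactSupport_nonneg_nonzero f_comp f_nonneg f_one
  refine ⟨of (fun t => ((∫ x, f x ∂μ)⁻¹ * f t : ℝ)) (by fun_prop)
    ((f_comp.mul_left (f := fun _ => (∫ x, f x ∂μ)⁻¹)).comp_left Complex.ofReal_zero), ?_⟩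
  simp only [of_apply]
  rw [integral_complex_ofReal, integral_const_mul, inv_mul_cancel₀ hpos.ne', Complex.ofReal_one]

/-- A continuous Hilbert space valued function is determined by its integrals
against `C_c(G)`. -/
lemma eq_zero_of_integral_smul {h : G → H} (hh : Continuous h)
    (h0 : ∀ f : CcG μ, ∫ t, f t • h t ∂μ = 0) (t₀ : G) : h t₀ = 0 := by
  obtain ⟨φ, φ_comp, φ_nonneg, φ_one⟩ :
    ∃ f : C(G, ℝ), HasCompactSupport f ∧ 0 ≤ f ∧ f t₀ ≠ 0 := exists_continuous_nonneg_pos t₀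
  let r : G → ℂ := fun t => ⟪h t₀, h t⟫_ℂ
  have cr : Continuous r := continuous_const.inner hh
  -- With this test function, pairing the integral with h(t₀) gives ∫ φ |⟨h(t₀), h(t)⟩|² dt, which
  -- is positive unless h(t₀) = 0.
  let f : CcG μ := of (fun t => (φ t : ℂ) * star (r t)) (by fun_prop)
    ((φ_comp.comp_left Complex.ofReal_zero).mul_right)
  have h1 : ∫ t, φ t * ‖r t‖ ^ 2 ∂μ = 0 := by
    have h2 := (innerSL ℂ (h t₀)).integral_comp_comm (f.integrable_smul hh)
    rw [h0 f, map_zero] at h2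
    have h3 : ∀ t, innerSL ℂ (h t₀) (f t • h t) = ((φ t * ‖r t‖ ^ 2 : ℝ) : ℂ) := by
      intro t
      rw [innerSL_apply_apply, inner_smul_right]
      change (φ t : ℂ) * star (r t) * r t = _
      rw [mul_assoc, RCLike.star_def, Complex.conj_mul']
      push_cast; rfl
    simp only [h3] at h2
    rw [integral_complex_ofReal] at h2
    exact_mod_cast h2
  by_contra hne
  have h4 : 0 < ∫ t, φ t * ‖r t‖ ^ 2 ∂μ := by
    refine Continuous.integral_pos_of_hasCompactSupport_nonneg_nonzero (x := t₀) (by fun_prop)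
      φ_comp.mul_right (fun t => mul_nonneg (φ_nonneg t) (sq_nonneg _)) ?_
    refine mul_ne_zero φ_one (pow_ne_zero _ (norm_ne_zero_iff.2 ?_))
    exact inner_self_ne_zero.2 hne
  exact h4.ne' h1

variable (π : G →* unitary (H →L[ℂ] H)) (hπ : IsContRep π)

include hπ in
lemma norm_integral_rep_le (f : CcG μ) (x : H) :
    ‖∫ t, f t • (π t : H →L[ℂ] H) x ∂μ‖ ≤ (∫ t, ‖f t‖ ∂μ) * ‖x‖ := by
  refine (norm_integral_le_integral_norm _).trans (le_of_eq ?_)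
  simp only [norm_smul, norm_unitary_apply]
  exact integral_mul_const _ _

variable {π}

/-- The operator `π̂(f) = ∫ f(t) π(t) dt`. -/
def intRep (f : CcG μ) : H →L[ℂ] H :=
  LinearMap.mkContinuous
    { toFun := fun x => ∫ t, f t • (π t : H →L[ℂ] H) x ∂μ
      map_add' := fun x y => by
        simp only [map_add, smul_add]
        exact integral_add (f.integrable_smul (hπ x)) (f.integrable_smul (hπ y))
      map_smul' := fun c x => by
        simp only [map_smul, smul_comm _ c, RingHom.id_apply]
        exact integral_smul c _ }
    (∫ t, ‖f t‖ ∂μ) (norm_integral_rep_le π hπ f)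

lemma intRep_apply (f : CcG μ) (x : H) : intRep hπ f x = ∫ t, f t • (π t : H →L[ℂ] H) x ∂μ := rfl

lemma norm_intRep_le (f : CcG μ) : ‖intRep hπ f‖ ≤ ∫ t, ‖f t‖ ∂μ :=
  LinearMap.mkContinuous_norm_le _ (integral_nonneg fun _ => norm_nonneg _) _

/-- `f ↦ π̂(f)` as a linear map. -/
def intRepₗ : CcG μ →ₗ[ℂ] H →L[ℂ] H where
  toFun f := intRep hπ f
  map_add' f g := by
    ext x
    simp only [intRep_apply, add_apply, add_smul]
    exact integral_add (f.integrable_smul (hπ x)) (g.integrable_smul (hπ x))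
  map_smul' c f := by
    ext x
    simp only [intRep_apply, smul_apply, mul_smul]
    exact integral_smul c _

lemma continuous_intRepₗ : Continuous (intRepₗ (μ := μ) hπ) :=
  continuous_of_bound _ fun _ _ => ⟨1, fun f _ => by
    rw [one_mul]; exact norm_intRep_le hπ f⟩

lemma intRep_translate (t : G) (f : CcG μ) (x : H) :
    intRep hπ (translate t f) x = (π t : H →L[ℂ] H) (intRep hπ f x) := by
  rw [intRep_apply, intRep_apply, ← (π t : H →L[ℂ] H).integral_comp_comm
    (f.integrable_smul (hπ x)),
    ← integral_mul_left_eq_self _ t]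
  refine integral_congr_ae (Eventually.of_forall fun s => ?_)
  simp

variable [T2Space G] [μ.Regular]

/-- The integrated form of `π` as a `*`-representation of `C_c(G)`. -/
def intRepHom : CcG μ →⋆ₙₐ[ℂ] (H →L[ℂ] H) where
  toFun := intRepₗ hπ
  map_smul' := (intRepₗ hπ).map_smul
  map_zero' := (intRepₗ hπ).map_zero
  map_add' := (intRepₗ hπ).map_add
  map_mul' f g := by
    ext x
    let T : CcG μ →ₗ[ℂ] H := (ContinuousLinearMap.apply ℂ H x).toLinearMap ∘ₗ intRepₗ hπ
    have hT : Continuous T :=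
      (ContinuousLinearMap.apply ℂ H x).continuous.comp (continuous_intRepₗ hπ)
    -- Multiplicativity comes from T(f) = π̂(f)x together with π̂(λ_t g) = π(t) π̂(g).
    have h := map_mul_eq_integral T hT f g
    change T (f * g) = intRep hπ f (intRep hπ g x)
    rw [h, intRep_apply]
    refine integral_congr_ae (Eventually.of_forall fun t => ?_)
    exact congrArg (f t • ·) (intRep_translate hπ t g x)
  map_star' f := by
    rw [ContinuousLinearMap.star_eq_adjoint, ContinuousLinearMap.eq_adjoint_iff]
    intro x y
    change ⟪intRep hπ (star f) x, y⟫_ℂ = ⟪x, intRep hπ f y⟫_ℂ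
    have h1 : ∀ (f : CcG μ) (x y : H), ⟪x, intRep hπ f y⟫_ℂ
        = ∫ t, f t * ⟪x, (π t : H →L[ℂ] H) y⟫_ℂ ∂μ := by
      intro f x y
      have := (innerSL ℂ x).integral_comp_comm (f.integrable_smul (hπ y))
      simp only [innerSL_apply_apply, inner_smul_right] at this
      exact this.symm
    -- The adjoint relation is ∫ F^* = conj ∫ F for F(t) = f(t)⟨x, π(t)y⟩, with π(t⁻¹) the adjoint
    -- of π(t).
    have h2 := integral_invol_Cc μ (f := fun t => f t * ⟪x, (π t : H →L[ℂ] H) y⟫_ℂ)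
      (f.continuous.mul (continuous_const.inner (hπ y))) f.hasCompactSupport.mul_right
    rw [← inner_conj_symm, h1, h1]
    rw [← RCLike.star_def, ← star_star (∫ t, f t * ⟪x, (π t : H →L[ℂ] H) y⟫_ℂ ∂μ), ← h2]
    congr 1
    refine integral_congr_ae (Eventually.of_forall fun t => ?_)
    have h3 : ⟪y, (π t : H →L[ℂ] H) x⟫_ℂ = star ⟪x, (π t⁻¹ : H →L[ℂ] H) y⟫_ℂ := by
      have h4 : (π t : H →L[ℂ] H) ((π t⁻¹ : H →L[ℂ] H) y) = y := by
        rw [← mul_apply_eq_comp, ← Submonoid.coe_mul, ← map_mul]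
        simp
      rw [RCLike.star_def, inner_conj_symm]
      conv_lhs => rw [← h4]
      exact Unitary.inner_map_map _ _ _
    simp only [invol, star_apply, h3, star_mul']
    ring

lemma intRepHom_apply (f : CcG μ) (x : H) :
    intRepHom hπ f x = ∫ t, f t • (π t : H →L[ℂ] H) x ∂μ := rfl

lemma continuous_intRepHom : Continuous (intRepHom (μ := μ) hπ) := continuous_intRepₗ hπ

end CcG

lemma continuous_unitization_fst : Continuous fun a : Unitization ℂ (CcG μ) => a.fst :=
  continuous_fst.comp continuous_induced_dom

lemma continuous_unitization_snd : Continuous fun a : Unitization ℂ (CcG μ) => a.snd :=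
  continuous_snd.comp continuous_induced_dom

variable [T2Space G] [μ.Regular] {π : G →* unitary (H →L[ℂ] H)} (hπ : IsContRep π)

/-- The integrated form of `π` as a `*`-representation of the unitalization of `C_c(G)`. -/
def integratedHom : Unitization ℂ (CcG μ) →⋆ₙₐ[ℂ] (H →L[ℂ] H) :=
  (Unitization.starLift (CcG.intRepHom (μ := μ) hπ)).toNonUnitalStarAlgHom

lemma integratedHom_apply (a : Unitization ℂ (CcG μ)) (x : H) :
    integratedHom hπ a x = integratedForm π a x := rfl

lemma integratedHom_eq (a : Unitization ℂ (CcG μ)) :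
    integratedHom hπ a = a.fst • (1 : H →L[ℂ] H) + CcG.intRepHom hπ a.snd := rfl

lemma continuous_integratedHom : Continuous (integratedHom (μ := μ) hπ) := by
  have : (integratedHom (μ := μ) hπ : Unitization ℂ (CcG μ) → H →L[ℂ] H)
      = fun a => a.fst • (1 : H →L[ℂ] H) + CcG.intRepHom hπ a.snd := funext (integratedHom_eq hπ)
  rw [this]
  exact (continuous_unitization_fst.smul continuous_const).add
    ((CcG.continuous_intRepHom hπ).comp continuous_unitization_snd)

end IntegratedForm

/-! ### From representations and derivations of `C_c(G)` back to the group -/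

section Disintegration

open scoped InnerProductSpace

variable {G : Type u} [Group G] [TopologicalSpace G] [IsTopologicalGroup G]
  [LocallyCompactSpace G] [T2Space G] [MeasurableSpace G] [BorelSpace G]
  {μ : Measure G} [μ.IsHaarMeasure] [μ.Regular]
  {H : Type v} [NormedAddCommGroup H] [InnerProductSpace ℂ H] [CompleteSpace H]

namespace CcG

/-- The null space of a `*`-representation. -/
def nullSpace (Φ : CcG μ →⋆ₙₐ[ℂ] (H →L[ℂ] H)) : Submodule ℂ H :=
  ⨅ f : CcG μ, LinearMap.ker (Φ f).toLinearMap

lemma mem_nullSpace {Φ : CcG μ →⋆ₙₐ[ℂ] (H →L[ℂ] H)} {x : H} :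
    x ∈ nullSpace Φ ↔ ∀ f, Φ f x = 0 := by
  simp [nullSpace]

lemma isClosed_nullSpace (Φ : CcG μ →⋆ₙₐ[ℂ] (H →L[ℂ] H)) : IsClosed (nullSpace Φ : Set H) := by
  have : (nullSpace Φ : Set H) = ⋂ f, {x | Φ f x = 0} := by
    ext x
    simp only [SetLike.mem_coe, mem_nullSpace, Set.mem_iInter, Set.mem_ofPred_eq]
  rw [this]
  exact isClosed_iInter fun f => isClosed_eq (Φ f).continuous continuous_const

instance (Φ : CcG μ →⋆ₙₐ[ℂ] (H →L[ℂ] H)) : (nullSpace Φ).HasOrthogonalProjection :=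
  have := (isClosed_nullSpace Φ).completeSpace_coe
  inferInstance

lemma inner_map_left (Φ : CcG μ →⋆ₙₐ[ℂ] (H →L[ℂ] H)) (f : CcG μ) (x y : H) :
    ⟪Φ f x, y⟫_ℂ = ⟪x, Φ (star f) y⟫_ℂ := by
  rw [map_star, ContinuousLinearMap.star_eq_adjoint, ContinuousLinearMap.adjoint_inner_right]

/-- Evaluation of a representation of `C_c(G)` at a vector. -/
def evalAt (Φ : CcG μ →⋆ₙₐ[ℂ] (H →L[ℂ] H)) (x : H) : CcG μ →ₗ[ℂ] H where
  toFun f := Φ f x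
  map_add' f g := by rw [map_add]; rfl
  map_smul' c f := by rw [map_smul]; rfl

lemma continuous_evalAt {Φ : CcG μ →⋆ₙₐ[ℂ] (H →L[ℂ] H)} (hΦ : Continuous Φ) (x : H) :
    Continuous (evalAt Φ x) := (ContinuousLinearMap.apply ℂ H x).continuous.comp hΦ

/-- Every continuous `*`-representation of `C_c(G)` is the integrated form of a continuous unitary
representation on the orthogonal complement of its null space. -/
lemma exists_unitary_rep_of_starRep (Φ : CcG μ →⋆ₙₐ[ℂ] (H →L[ℂ] H)) (hΦ : Continuous Φ) :
    ∃ π : G →* unitary (H →L[ℂ] H), IsContRep π ∧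
      (∀ t, ∀ x ∈ nullSpace Φ, (π t : H →L[ℂ] H) x = x) ∧
      ∀ f y, Φ f y = ∫ t, f t • (π t : H →L[ℂ] H) (y - (nullSpace Φ).starProjection y) ∂μ := by
  -- G translates f in Φ(f)x and acts trivially on the null space. The two kinds of vectors are
  -- mutually orthogonal and together total.
  let e : (CcG μ × H) ⊕ nullSpace Φ → H := Sum.elim (fun p => Φ p.1 p.2) Subtype.val
  let a : G → (CcG μ × H) ⊕ nullSpace Φ → (CcG μ × H) ⊕ nullSpace Φ :=
    fun t => Sum.map (fun p => (translate t p.1, p.2)) id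
  have he : (Submodule.span ℂ (Set.range e)).topologicalClosure = ⊤ := by
    rw [Submodule.topologicalClosure_eq_top_iff, Submodule.eq_bot_iff]
    intro w hw
    have h1 : ∀ i, ⟪e i, w⟫_ℂ = 0 := fun i =>
      (Submodule.mem_orthogonal _ _).1 hw _ (Submodule.subset_span ⟨i, rfl⟩)
    have h2 : w ∈ nullSpace Φ := by
      refine mem_nullSpace.2 fun f => ext_inner_left ℂ fun x => ?_
      have h3 := h1 (Sum.inl (star f, x))
      change ⟪Φ (star f) x, w⟫_ℂ = 0 at h3
      rw [inner_map_left, star_star] at h3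
      rw [h3, inner_zero_right]
    exact inner_self_eq_zero.1 (h1 (Sum.inr ⟨w, h2⟩))
  have ha : ∀ t i j, ⟪e (a t i), e (a t j)⟫_ℂ = ⟪e i, e j⟫_ℂ := by
    have h0 : ∀ (f : CcG μ) (x : H) (y : nullSpace Φ), ⟪Φ f x, (y : H)⟫_ℂ = 0 := fun f x y => by
      rw [inner_map_left, mem_nullSpace.1 y.2, inner_zero_right]
    rintro t (⟨f, x⟩ | y) (⟨g, z⟩ | w)
    · change ⟪Φ (translate t f) x, Φ (translate t g) z⟫_ℂ = ⟪Φ f x, Φ g z⟫_ℂ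
      rw [inner_map_left, inner_map_left, ← mul_apply_eq_comp, ← mul_apply_eq_comp, ← map_mul,
        ← map_mul, star_translate_mul_translate]
    · exact (h0 _ x w).trans (h0 f x w).symm
    · change ⟪(y : H), Φ (translate t g) z⟫_ℂ = ⟪(y : H), Φ g z⟫_ℂ
      rw [← inner_conj_symm, h0, ← inner_conj_symm, h0]
    · rfl
  obtain ⟨π, hπ⟩ := exists_unitary_rep (G := G) e he a
    (by rintro (⟨f, x⟩ | y) <;> simp [a, translate_one])
    (by rintro s t (⟨f, x⟩ | y) <;> simp [a, translate_mul]) ha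
  have hπ1 : ∀ t f x, (π t : H →L[ℂ] H) (Φ f x) = Φ (translate t f) x := fun t f x =>
    hπ t (Sum.inl (f, x))
  have hπ2 : ∀ t, ∀ x ∈ nullSpace Φ, (π t : H →L[ℂ] H) x = x := fun t x hx =>
    hπ t (Sum.inr ⟨x, hx⟩)
  have cπ : IsContRep π := by
    refine isContRep_of_total π he ?_
    rintro (⟨f, x⟩ | y)
    · exact (continuous_translate (evalAt Φ x) (continuous_evalAt hΦ x) f).congr fun t =>
        (hπ1 t f x).symm
    · exact continuous_const.congr fun t => (hπ2 t y y.2).symm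
  refine ⟨π, cπ, hπ2, fun f y => ?_⟩
  have h : Φ f = intRep cπ f ∘L (ContinuousLinearMap.id ℂ H - (nullSpace Φ).starProjection) := by
    refine ContinuousLinearMap.ext_on (s := Set.range e)
      (Submodule.dense_iff_topologicalClosure_eq_top.2 he) ?_
    rintro _ ⟨⟨g, x⟩ | w, rfl⟩
    · have h1 : (nullSpace Φ).starProjection (Φ g x) = 0 := by
        refine (Submodule.starProjection_apply_eq_zero_iff _).2 ?_
        refine (Submodule.mem_orthogonal' _ _).2 fun u hu => ?_
        rw [inner_map_left, mem_nullSpace.1 hu, inner_zero_right]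
      change Φ f (Φ g x) = intRep cπ f (Φ g x - (nullSpace Φ).starProjection (Φ g x))
      rw [h1, sub_zero, ← mul_apply_eq_comp, ← map_mul]
      refine (map_mul_eq_integral (evalAt Φ x) (continuous_evalAt hΦ x) f g).trans ?_
      rw [intRep_apply]
      simp only [hπ1]
      rfl
    · change Φ f (w : H) = intRep cπ f ((w : H) - (nullSpace Φ).starProjection (w : H))
      rw [Submodule.starProjection_eq_self_iff.2 w.2, sub_self, map_zero, mem_nullSpace.1 w.2]
  exact DFunLike.congr_fun h y

lemma integral_smul_sub (f : CcG μ) {h k : G → H} (hh : Continuous h) (hk : Continuous k) :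
    ∫ t, f t • (h t - k t) ∂μ = ∫ t, f t • h t ∂μ - ∫ t, f t • k t ∂μ := by
  simp only [smul_sub]
  exact integral_sub (f.integrable_smul hh) (f.integrable_smul hk)

/-- A derivation of `C_c(G)` is given by a `1`-cocycle of `G`, and is inner if the cocycle
is a coboundary. -/
lemma exists_cocycle_of_derivation (Φ : CcG μ →⋆ₙₐ[ℂ] (H →L[ℂ] H)) (hΦ : Continuous Φ)
    (θ : CcG μ →ₗ[ℂ] H) (hθ : Continuous θ)
    (hd : ∀ f g : CcG μ, θ (f * g) = Φ f (θ g) + eps g • θ f) :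
    ∃ (π : G →* unitary (H →L[ℂ] H)) (b : G → H), IsContRep π ∧ Continuous b ∧
      (∀ s t, b (s * t) = b s + (π s : H →L[ℂ] H) (b t)) ∧
      ((∃ C, ∀ f : CcG μ, ‖θ f‖ ≤ C * ∫ t, ‖f t‖ ∂μ) → ∃ C, ∀ t, ‖b t‖ ≤ C) ∧
      ((∃ ξ, ∀ t, b t = ξ - (π t : H →L[ℂ] H) ξ) →
        ∃ ξ : H, ∀ f, θ f = eps f • ξ - Φ f ξ) := by
  obtain ⟨π, cπ, hπ0, hπ⟩ := exists_unitary_rep_of_starRep Φ hΦ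
  let N := nullSpace Φ
  let Q : H →L[ℂ] H := N.starProjection
  obtain ⟨g, hg⟩ := exists_integral_eq_one (μ := μ)
  -- Formally λ_t g = δ_t ∗ g, so this should be ε(g) times the value of θ at δ_t. The projection Q
  -- is removed because Φ vanishes on the null space while π is trivial there.
  let b : CcG μ → G → H := fun g t => θ (translate t g) - (π t : H →L[ℂ] H) (θ g - Q (θ g))
  have cb : ∀ g, Continuous (b g) := fun g => (continuous_translate θ hθ g).sub (cπ _)
  have hb : ∀ g f, ∫ t, f t • b g t ∂μ = eps g • θ f := by
    intro g f
    rw [f.integral_smul_sub (continuous_translate θ hθ g) (cπ _), ← map_mul_eq_integral θ hθ,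
      hd, ← hπ, add_sub_cancel_left]
  -- Both sides have the same integral against every f, namely ε(g') θ(f), and both are continuous
  -- in t.
  have hbg : ∀ g' t, b g' t = eps g' • b g t := by
    intro g' t
    refine sub_eq_zero.1 (eq_zero_of_integral_smul (μ := μ)
      (h := fun t => b g' t - eps g' • b g t) ((cb g').sub ((cb g).const_smul _))
      (fun f => ?_) t)
    rw [f.integral_smul_sub (k := fun t => eps g' • b g t) (cb g') ((cb g).const_smul _), hb]
    simp only [smul_comm _ (eps g')]
    rw [integral_smul, hb, (show eps g = 1 from hg), one_smul, sub_self]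
  have Q0 : ∀ f x, Φ f (Q x) = 0 := fun f x =>
    mem_nullSpace.1 (Submodule.starProjection_apply_mem N x) f
  have QQ : ∀ x, Q (Q x) = Q x := fun x =>
    Submodule.starProjection_eq_self_iff.2 (Submodule.starProjection_apply_mem N x)
  have πQ : ∀ t x, (π t : H →L[ℂ] H) (Q x) = Q x := fun t x =>
    hπ0 t _ (Submodule.starProjection_apply_mem N x)
  have Qπ : ∀ t x, Q ((π t : H →L[ℂ] H) x) = Q x := by
    intro t x
    rw [← sub_eq_zero, ← map_sub]
    refine (Submodule.starProjection_apply_eq_zero_iff _).2 ?_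
    refine (Submodule.mem_orthogonal _ _).2 fun u hu => ?_
    rw [inner_sub_right, sub_eq_zero]
    conv_lhs => rw [← hπ0 t u hu]
    exact Unitary.inner_map_map _ _ _
  -- The independence of g just shown is applied to λ_t g, which also has integral 1.
  have hmul : ∀ s t, b g (s * t) = b g s + (π s : H →L[ℂ] H) (b g t - Q (b g t)) := by
    intro s t
    have h1 := hbg (translate t g) s
    rw [show eps (translate t g) = 1 from (integral_translate t g).trans hg, one_smul] at h1
    rw [← h1]
    simp only [b, translate_mul, map_mul, Submonoid.coe_mul, mul_apply_eq_comp, map_sub, Qπ, πQ, QQ]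
    abel
  have hQm : ∀ s t, Q (b g (s * t)) = Q (b g s) := fun s t => by
    rw [hmul, map_add, Qπ, map_sub Q (b g t) (Q (b g t)), QQ, sub_self, add_zero]
  -- The null space component of b is a constant c rather than a cocycle. Subtracting it leaves a
  -- genuine cocycle, and c returns in the implementing vector.
  have hQ : ∀ s, Q (b g s) = Q (b g 1) := fun s => by
    rw [← hQm 1 s, one_mul]
  have Qc : ∀ f, Φ f (Q (b g 1)) = 0 := fun f => Q0 f _
  generalize Q (b g 1) = c at hQ Qc
  refine ⟨π, fun t => b g t - Q (b g t), cπ, (cb g).sub (Q.continuous.comp (cb g)), ?_, ?_, ?_⟩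
  · intro s t
    simp only [hmul s t, map_add, map_sub, Qπ, πQ, QQ]
    abel
  · rintro ⟨C, hC⟩
    refine ⟨C * (∫ t, ‖g t‖ ∂μ) + ‖θ g - Q (θ g)‖ + ‖c‖, fun t => ?_⟩
    change ‖b g t - Q (b g t)‖ ≤ _
    rw [hQ t]
    refine (norm_sub_le _ _).trans (add_le_add_left ((norm_sub_le _ _).trans ?_) _)
    rw [norm_unitary_apply, ← integral_norm_translate t g]
    exact add_le_add_left (hC _) _
  · rintro ⟨ξ, hξ⟩
    -- Integrating b(t) = c + ξ - π(t)ξ against f gives θ(f), and Φ(f)ξ = ∫ f(t) π(t)ξ dt - ε(f) Qξ;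
    -- this accounts for the correction Qξ.
    refine ⟨c + (ξ - Q ξ), fun f => ?_⟩
    have h1 : ∀ t, b g t = (c + ξ) - (π t : H →L[ℂ] H) ξ := by
      intro t
      have := hξ t
      simp only [hQ t] at this
      rw [sub_eq_iff_eq_add] at this
      rw [this]; abel
    have h2 := hb g f
    rw [show eps g = 1 from hg, one_smul] at h2
    have h3 := hπ f ξ
    have h4 : ∀ x : H, ∫ t, f t • x ∂μ = eps f • x := fun x => integral_smul_const _ _
    simp only [h1] at h2
    rw [f.integral_smul_sub continuous_const (cπ ξ), h4] at h2
    simp only [map_sub] at h3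
    change _ = ∫ t, f t • ((π t : H →L[ℂ] H) ξ - (π t : H →L[ℂ] H) (Q ξ)) ∂μ at h3
    simp only [πQ] at h3
    rw [f.integral_smul_sub (cπ ξ) continuous_const, h4] at h3
    rw [← h2, map_add, map_sub, Q0, Qc, h3, smul_add, smul_add, smul_sub]
    abel

end CcG

end Disintegration

/-! ### Property (FH) for `C_c(G)` under property (T), and for L¹(G) -/

section FH

open scoped InnerProductSpace

variable {G : Type u} [Group G] [TopologicalSpace G] [IsTopologicalGroup G]
  [LocallyCompactSpace G] [T2Space G] [MeasurableSpace G] [BorelSpace G]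
  {μ : Measure G} [μ.IsHaarMeasure] [μ.Regular]

lemma propertyFH_of_propertyT (hT : PropertyT.{u, v} G) :
    PropertyFH.{u, v} (CcG μ) (CcG.eps (μ := μ)) := by
  intro H _ _ _ Φ θ hΦ hθ hd
  obtain ⟨π, b, cπ, cb, hb, -, h⟩ := CcG.exists_cocycle_of_derivation Φ hΦ θ hθ hd
  exact h (coboundary_of_propertyT hT π b hb cπ cb)

namespace L1G

/-- The inclusion `C_c(G) → L¹(G)` as a `*`-homomorphism. -/
def ofCcHom : CcG μ →⋆ₙₐ[ℂ] L1G μ where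
  toFun := ofCc
  map_smul' c f := (mk_smul f.integrable c).symm
  map_zero' := mk_zero
  map_add' f g := (mk_add f.integrable g.integrable).symm
  map_mul' f g := (mk_mul f.integrable g.integrable).symm
  map_star' f := (star_mk f.integrable).symm

lemma norm_ofCcHom (f : CcG μ) : ‖ofCcHom f‖ = ∫ t, ‖f t‖ ∂μ := CcG.norm_toL1 f

lemma continuous_ofCcHom : Continuous (ofCcHom (μ := μ)) :=
  CcG.continuous_of_bound (ofCcHom (μ := μ) : CcG μ →ₗ[ℂ] L1G μ) fun _ _ =>
    ⟨1, fun f _ => by rw [one_mul]; exact (norm_ofCcHom f).le⟩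

lemma eps_ofCcHom (f : CcG μ) : eps (ofCcHom f) = CcG.eps f := integral_mk f.integrable

variable (μ) in
-- The operator norm of θ bounds the cocycle of its restriction to `C_c(G)`, since translation
-- preserves the L¹-norm. Bounded cocycles are coboundaries, and both sides of the resulting
-- identity are continuous.
lemma propertyFH : PropertyFH.{u, v} (L1G μ) (eps (μ := μ)) := by
  intro H _ _ _ Φ θ hΦ hθ hd
  let θ' : L1G μ →L[ℂ] H := ⟨θ, hθ⟩
  obtain ⟨π, b, cπ, cb, hb, hB, h⟩ := CcG.exists_cocycle_of_derivation (Φ.comp ofCcHom)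
    (hΦ.comp continuous_ofCcHom) (θ ∘ₗ (ofCcHom (μ := μ) : CcG μ →ₗ[ℂ] L1G μ))
    (hθ.comp continuous_ofCcHom) (fun f g => by
      change θ (ofCcHom (f * g)) = Φ (ofCcHom f) (θ (ofCcHom g)) + CcG.eps g • θ (ofCcHom f)
      rw [map_mul, hd, eps_ofCcHom])
  obtain ⟨ξ, hξ⟩ := h (coboundary_of_bounded π b hb (hB ⟨‖θ'‖, fun f => by
    rw [← norm_ofCcHom]
    exact θ'.le_opNorm _⟩))
  refine ⟨ξ, fun a => denseRange_ofCc.induction_on a ?_ fun f => ?_⟩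
  · refine isClosed_eq hθ ((continuous_integral'.smul continuous_const).sub ?_)
    exact (ContinuousLinearMap.apply ℂ H ξ).continuous.comp hΦ
  · exact (hξ f).trans (congrArg (· • ξ - _) (eps_ofCcHom f).symm)

end L1G

end FH

/-! ### The augmentation ideal: from property (FH) to property (CH) -/

section CH

open scoped InnerProductSpace

variable {G : Type u} [Group G] [TopologicalSpace G] [IsTopologicalGroup G]
  [LocallyCompactSpace G] [T2Space G] [MeasurableSpace G] [BorelSpace G]
  {μ : Measure G} [μ.IsHaarMeasure] [μ.Regular]

lemma CcG.continuous_eps : Continuous (CcG.eps (μ := μ)) :=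
  CcG.continuous_of_bound (CcG.eps (μ := μ) : CcG μ →ₗ[ℂ] ℂ) fun _ _ => ⟨1, fun f _ => by
    rw [one_mul]; exact norm_integral_le_integral_norm _⟩

namespace CcTilde0

lemma fst_eq (a : CcTilde0 μ) :
    (a : Unitization ℂ (CcG μ)).fst = -CcG.eps (a : Unitization ℂ (CcG μ)).snd :=
  eq_neg_of_add_eq_zero_left a.2

/-- The linear bijection `f ↦ f - ε_G(f)` of `C_c(G)` onto the augmentation ideal. -/
def ofCc : CcG μ →ₗ[ℂ] CcTilde0 μ where
  toFun f := ⟨Unitization.inl (-CcG.eps f) + Unitization.inr f, by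
    change epsTilde μ _ = 0
    rw [epsTilde_apply]
    simp only [Unitization.fst_add, Unitization.fst_inl, Unitization.fst_inr, Unitization.snd_add,
      Unitization.snd_inl, Unitization.snd_inr, zero_add, add_zero]
    exact neg_add_cancel _⟩
  map_add' f g := by
    refine Subtype.ext (Unitization.ext ?_ ?_)
    · simp; ring
    · simp
  map_smul' c f := by
    refine Subtype.ext (Unitization.ext ?_ ?_)
    · simp
    · simp

lemma fst_ofCc (f : CcG μ) : (ofCc f : Unitization ℂ (CcG μ)).fst = -CcG.eps f := by simp [ofCc]

lemma snd_ofCc (f : CcG μ) : (ofCc f : Unitization ℂ (CcG μ)).snd = f := by simp [ofCc]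

lemma ofCc_snd (a : CcTilde0 μ) : ofCc (a : Unitization ℂ (CcG μ)).snd = a := by
  refine Subtype.ext (Unitization.ext ?_ ?_)
  · rw [fst_ofCc, fst_eq]
  · rw [snd_ofCc]

/-- This is f ∗ g - ε(f)ε(g) expanded in f - ε(f) and g - ε(g). The two extra terms are exactly what
turns a module map into a derivation. -/
lemma ofCc_mul (f g : CcG μ) :
    ofCc (f * g) = ofCc f * ofCc g + CcG.eps f • ofCc g + CcG.eps g • ofCc f := by
  refine Subtype.ext (Unitization.ext ?_ ?_)
  · simp [fst_ofCc, mul_comm]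
  · simp [fst_ofCc, snd_ofCc]
    abel

lemma ofCc_star (f : CcG μ) : ofCc (star f) = star (ofCc f) := by
  refine Subtype.ext (Unitization.ext ?_ ?_)
  · simp [fst_ofCc, map_star]
  · simp [snd_ofCc]

lemma continuous_ofCc : Continuous (ofCc (μ := μ)) := by
  refine continuous_induced_rng.2 (continuous_induced_rng.2 ?_)
  refine (CcG.continuous_eps.neg.prodMk continuous_id).congr fun f => ?_
  exact Prod.ext (fst_ofCc f).symm (snd_ofCc f).symm

variable {H : Type v} [NormedAddCommGroup H] [InnerProductSpace ℂ H] [CompleteSpace H]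

/-- The extension of a `*`-representation of the augmentation ideal to `C_c(G)`. -/
def extend (Φ : CcTilde0 μ →⋆ₙₐ[ℂ] (H →L[ℂ] H)) : CcG μ →⋆ₙₐ[ℂ] (H →L[ℂ] H) where
  toFun f := Φ (ofCc f) + CcG.eps f • (1 : H →L[ℂ] H)
  map_smul' c f := by
    rw [map_smul, map_smul, map_smul, smul_eq_mul, mul_smul, smul_add]; rfl
  map_zero' := by simp
  map_add' f g := by
    rw [map_add, map_add, map_add, add_smul]; abel
  map_mul' f g := by
    rw [ofCc_mul, map_add, map_add, map_mul, map_smul, map_smul, map_mul]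
    simp only [add_mul, mul_add, smul_mul_assoc, mul_smul_comm, one_mul, mul_one, mul_smul,
      smul_add, smul_comm (CcG.eps g) (CcG.eps f)]
    abel
  map_star' f := by
    rw [ofCc_star, map_star, map_star, star_add, star_smul, star_one]

end CcTilde0

/-- With Φ extended by f ↦ Φ(f - ε(f)) + ε(f), the map f ↦ Λ(f - ε(f)) is a derivation. If ξ
implements it, the ε(f)ξ terms cancel and -ξ implements Λ. -/
lemma propertyCH_of_propertyFH (h : PropertyFH.{u, v} (CcG μ) (CcG.eps (μ := μ))) :
    PropertyCH.{u, v} (CcTilde0 μ) := by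
  intro H _ _ _ Φ Λ hΦ hΛ hm
  obtain ⟨ξ, hξ⟩ := h H (CcTilde0.extend Φ) (Λ ∘ₗ CcTilde0.ofCc)
    ((hΦ.comp CcTilde0.continuous_ofCc).add (CcG.continuous_eps.smul continuous_const))
    (hΛ.comp CcTilde0.continuous_ofCc) (fun f g => by
      change Λ (CcTilde0.ofCc (f * g)) = Φ (CcTilde0.ofCc f) (Λ (CcTilde0.ofCc g))
        + CcG.eps f • Λ (CcTilde0.ofCc g) + CcG.eps g • Λ (CcTilde0.ofCc f)
      rw [CcTilde0.ofCc_mul, map_add, map_add, hm, map_smul, map_smul])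
  refine ⟨-ξ, fun a => ?_⟩
  have h1 := hξ (a : Unitization ℂ (CcG μ)).snd
  change Λ (CcTilde0.ofCc (a : Unitization ℂ (CcG μ)).snd) = _ -
    (Φ (CcTilde0.ofCc (a : Unitization ℂ (CcG μ)).snd) ξ
      + CcG.eps (a : Unitization ℂ (CcG μ)).snd • ξ) at h1
  rw [CcTilde0.ofCc_snd] at h1
  rw [h1, map_neg]; abel

lemma propertyCHRep_of_propertyCH (h : PropertyCH.{u, v} (CcTilde0 μ)) :
    PropertyCHRep.{u, v} μ := by
  intro H _ _ _ π Ξ hπ hΞ hm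
  exact h H ((integratedHom hπ).comp (NonUnitalStarSubalgebraClass.subtype (CcTilde0 μ))) Ξ
    ((continuous_integratedHom hπ).comp continuous_subtype_val) hΞ hm

end CH

/-! ### Guichardet's construction of a module map not given by a vector -/

section Guichardet

open scoped InnerProductSpace

variable {G : Type u} [Group G] [TopologicalSpace G]
  {H : Type v} [NormedAddCommGroup H] [InnerProductSpace ℂ H] [CompleteSpace H]

/-- The countable Hilbert sum of copies of `H`. -/
abbrev HilbertSum (H : Type v) [NormedAddCommGroup H] : Type v := lp (fun _ : ℕ => H) 2

/-- The coordinate maps of the Hilbert sum. -/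
def coordL (n : ℕ) : HilbertSum H →L[ℂ] H := lp.evalCLM ℂ (fun _ : ℕ => H) 2 n

lemma coordL_apply (n : ℕ) (w : HilbertSum H) : coordL n w = w n := rfl

/-- The diagonal representation on the Hilbert sum. -/
lemma exists_sum_rep (π : G →* unitary (H →L[ℂ] H)) (hπ : IsContRep π) :
    ∃ σ : G →* unitary (HilbertSum H →L[ℂ] HilbertSum H), IsContRep σ ∧
      ∀ t w n, coordL n ((σ t : HilbertSum H →L[ℂ] HilbertSum H) w)
        = (π t : H →L[ℂ] H) (coordL n w) := by
  let e : ℕ × H → HilbertSum H := fun i => lp.single 2 i.1 i.2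
  have inn : ∀ n x w, ⟪e (n, x), w⟫_ℂ = ⟪x, coordL n w⟫_ℂ := fun n x w =>
    lp.inner_single_left n x w
  have he : (Submodule.span ℂ (Set.range e)).topologicalClosure = ⊤ := by
    rw [Submodule.topologicalClosure_eq_top_iff, Submodule.eq_bot_iff]
    intro w hw
    ext n
    refine ext_inner_left ℂ fun x => ?_
    have := (Submodule.mem_orthogonal _ _).1 hw _ (Submodule.subset_span ⟨(n, x), rfl⟩)
    exact ((inn n x w).symm.trans this).trans (inner_zero_right _).symm
  have hs : ∀ t n m x, coordL n (e (m, (π t : H →L[ℂ] H) x))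
      = (π t : H →L[ℂ] H) (coordL n (e (m, x))) := by
    intro t n m x
    by_cases h : n = m
    · subst h; simp [e, coordL_apply]
    · simp [e, coordL_apply, h]
  obtain ⟨σ, hσ⟩ := exists_unitary_rep (G := G) e he (fun t i => (i.1, (π t : H →L[ℂ] H) i.2))
    (by simp) (by simp) (by
      rintro t ⟨n, x⟩ ⟨m, y⟩
      simp only [inn, hs]
      exact Unitary.inner_map_map _ _ _)
  refine ⟨σ, isContRep_of_total σ he ?_, fun t w n => ?_⟩
  · rintro ⟨n, x⟩
    simp only [hσ]
    exact (lp.isometry_single n).continuous.comp (hπ x)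
  · have : coordL n ∘L (σ t : HilbertSum H →L[ℂ] HilbertSum H)
        = (π t : H →L[ℂ] H) ∘L coordL n := by
      refine ContinuousLinearMap.ext_on (s := Set.range e)
        (Submodule.dense_iff_topologicalClosure_eq_top.2 he) ?_
      rintro _ ⟨⟨m, x⟩, rfl⟩
      change coordL n ((σ t : HilbertSum H →L[ℂ] HilbertSum H) (e (m, x))) = _
      rw [hσ]
      exact hs t n m x
    exact DFunLike.congr_fun this w

variable [IsTopologicalGroup G] [LocallyCompactSpace G] [T2Space G] [MeasurableSpace G]
  [BorelSpace G] {μ : Measure G} [μ.IsHaarMeasure] [μ.Regular]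

/-- A sequence of locally bounded linear maps on `C_c(G)` with summable bounds defines a
continuous linear map into the Hilbert sum. -/
lemma exists_sum_map (c : ℕ → CcG μ →ₗ[ℂ] H)
    (hc : ∀ K : Set G, IsCompact K → ∃ a : ℕ → ℝ, Summable a ∧
      ∀ (f : CcG μ) (n : ℕ), tsupport f ⊆ K → ‖c n f‖ ≤ a n * ∫ t, ‖f t‖ ∂μ) :
    ∃ M : CcG μ →ₗ[ℂ] HilbertSum H, Continuous M ∧ ∀ f n, coordL n (M f) = c n f := by
  have hsum : ∀ f, Summable fun n => (lp.single 2 n (c n f) : HilbertSum H) := by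
    intro f
    obtain ⟨a, ha, h⟩ := hc _ f.hasCompactSupport
    refine Summable.of_norm_bounded (ha.mul_right (∫ t, ‖f t‖ ∂μ)) fun n => ?_
    rw [lp.norm_single (by norm_num)]
    exact h f n subset_rfl
  let M : CcG μ →ₗ[ℂ] HilbertSum H :=
    { toFun := fun f => ∑' n, lp.single 2 n (c n f)
      map_add' := fun f g => by
        simp only [map_add, lp.single_add]
        exact (hsum f).tsum_add (hsum g)
      map_smul' := fun z f => by
        simp only [map_smul, lp.single_smul, RingHom.id_apply]
        exact (hsum f).tsum_const_smul z }
  refine ⟨M, CcG.continuous_of_bound M fun K hK => ?_, fun f n => ?_⟩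
  · obtain ⟨a, ha, h⟩ := hc K hK
    refine ⟨∑' n, a n, fun f hf => ?_⟩
    have hb : ∀ n, ‖(lp.single 2 n (c n f) : HilbertSum H)‖ ≤ a n * ∫ t, ‖f t‖ ∂μ := fun n => by
      rw [lp.norm_single (by norm_num)]
      exact h f n hf
    rw [← tsum_mul_right]
    exact tsum_of_norm_bounded (ha.mul_right _).hasSum hb
  · change coordL n (∑' m, lp.single 2 m (c m f)) = c n f
    rw [(coordL n).map_tsum (hsum f), tsum_eq_single n]
    · simp [coordL_apply]
    · intro m hm
      simp [coordL_apply, hm.symm]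

lemma coordL_intRep {π : G →* unitary (H →L[ℂ] H)} (hπ : IsContRep π)
    {σ : G →* unitary (HilbertSum H →L[ℂ] HilbertSum H)} (hσ : IsContRep σ)
    (h : ∀ t w n, coordL n ((σ t : HilbertSum H →L[ℂ] HilbertSum H) w)
        = (π t : H →L[ℂ] H) (coordL n w)) (f : CcG μ) (w : HilbertSum H) (n : ℕ) :
    coordL n (CcG.intRepHom hσ f w) = CcG.intRepHom hπ f (coordL n w) := by
  rw [CcG.intRepHom_apply, CcG.intRepHom_apply]
  refine ((coordL n).integral_comp_comm (f.integrable_smul (hσ w))).symm.trans ?_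
  simp only [map_smul, h]

/-- A vector annihilated by `C_c^0(G)` is invariant. -/
lemma invariant_of_intRep_eq_zero {π : G →* unitary (H →L[ℂ] H)} (hπ : IsContRep π) {x : H}
    (h : ∀ f : CcG μ, CcG.eps f = 0 → CcG.intRepHom hπ f x = 0) (t : G) :
    (π t : H →L[ℂ] H) x = x := by
  obtain ⟨g, hg⟩ := CcG.exists_integral_eq_one (μ := μ)
  replace hg : CcG.eps g = 1 := hg
  let c := CcG.intRepHom hπ g x
  -- As f - ε(f)g has integral zero, π̂(f)x = ε(f)c for all f. So the orbit of x is constantly c,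
  -- and t = 1 gives c = x.
  have key : ∀ t, (π t : H →L[ℂ] H) x - c = 0 := by
    refine CcG.eq_zero_of_integral_smul (μ := μ) ((hπ x).sub continuous_const) fun f => ?_
    have h1 := h (f - CcG.eps f • g) (by rw [map_sub, map_smul, hg]; simp)
    rw [map_sub, map_smul] at h1
    rw [f.integral_smul_sub (hπ x) continuous_const, ← CcG.intRepHom_apply hπ]
    exact (congrArg _ (integral_smul_const _ _)).trans h1
  have h1 := key 1
  rw [map_one] at h1
  rw [sub_eq_zero.1 (key t), ← sub_eq_zero.1 h1]
  rfl

/-- The Guichardet construction: almost invariant unit vectors without non-zero invariant vectors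
give a module map on `C_c^0(G)` that is not given by a vector. -/
lemma exists_outer_module_map [SecondCountableTopology G] (μ : Measure G) [μ.IsHaarMeasure]
    [μ.Regular] (π : G →* unitary (H →L[ℂ] H)) (hπ : IsContRep π)
    (hai : ∀ K : Set G, IsCompact K → ∀ δ : ℝ, 0 < δ →
      ∃ ξ : H, ‖ξ‖ = 1 ∧ ∀ t ∈ K, ‖(π t : H →L[ℂ] H) ξ - ξ‖ < δ)
    (hno : ∀ ξ : H, (∀ t, (π t : H →L[ℂ] H) ξ = ξ) → ξ = 0) :
    ∃ (σ : G →* unitary (HilbertSum H →L[ℂ] HilbertSum H)) (hσ : IsContRep σ)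
      (Ξ : CcTilde0 μ →ₗ[ℂ] HilbertSum H), Continuous Ξ ∧
      (∀ a b : CcTilde0 μ, Ξ (a * b) = integratedHom hσ (a : Unitization ℂ (CcG μ)) (Ξ b)) ∧
      ∀ η, ∃ f : CcG μ, CcG.eps f = 0 ∧ Ξ (CcTilde0.ofCc f) ≠ CcG.intRepHom hσ f η := by
  obtain ⟨σ, hσ, hc⟩ := exists_sum_rep π hπ
  let K : CompactExhaustion G := CompactExhaustion.choice G
  -- The tolerance absorbs the later factor n and leaves the summable 2⁻ⁿ; n + 1 keeps it positive
  -- at n = 0. Second countability provides the exhaustion K.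
  choose ξ ξ1 hξ using fun n : ℕ => hai (K n) (K.isCompact n) (1 / ((n + 1) * 2 ^ n))
    (by positivity)
  -- Coordinate n of the module map is π̂(f - ε(f)) applied to n ξ_n. The factor n makes (n ξ_n)
  -- fail to be square summable.
  let c : ℕ → CcG μ →ₗ[ℂ] H := fun n =>
    (n : ℂ) • (CcG.evalAt (CcG.intRepHom hπ) (ξ n)
      - (CcG.eps (μ := μ) : CcG μ →ₗ[ℂ] ℂ).smulRight (ξ n))
  have hcn : ∀ n f, c n f = (n : ℂ) • (CcG.intRepHom hπ f (ξ n) - CcG.eps f • ξ n) :=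
    fun _ _ => rfl
  have hci : ∀ n f, c n f = (n : ℂ) • ∫ t, f t • ((π t : H →L[ℂ] H) (ξ n) - ξ n) ∂μ := by
    intro n f
    rw [hcn, f.integral_smul_sub (hπ _) continuous_const, CcG.intRepHom_apply]
    congr 2
    exact (integral_smul_const _ _).symm
  have cb : ∀ n (f : CcG μ) (δ : ℝ),
      (∀ t ∈ tsupport f, ‖(π t : H →L[ℂ] H) (ξ n) - ξ n‖ ≤ δ) →
      ‖c n f‖ ≤ n * δ * ∫ t, ‖f t‖ ∂μ := by
    intro n f δ hδ
    rw [hci, norm_smul, Complex.norm_natCast, mul_assoc]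
    refine mul_le_mul_of_nonneg_left ?_ (Nat.cast_nonneg n)
    rw [← integral_const_mul]
    refine norm_integral_le_of_norm_le (f.integrable.norm.const_mul δ)
      (Eventually.of_forall fun t => ?_)
    by_cases ht : t ∈ tsupport f
    · rw [norm_smul, mul_comm]
      exact mul_le_mul_of_nonneg_right (hδ t ht) (norm_nonneg _)
    · simp [image_eq_zero_of_notMem_tsupport ht]
  obtain ⟨M, cM, hM⟩ := exists_sum_map c (by
    intro L hL
    obtain ⟨N, hN⟩ := K.exists_superset_of_isCompact hL
    -- From N on, L lies in K_n and the chosen tolerance applies. For the finitely many smaller n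
    -- the trivial bound ‖π(t)ξ_n - ξ_n‖ ≤ 2 is enough.
    refine ⟨fun n => if N ≤ n then (1 / 2) ^ n else n * 2, ?_, fun f n hf => ?_⟩
    · refine (summable_nat_add_iff N).1 ?_
      simpa using (summable_nat_add_iff N).2 summable_geometric_two
    · by_cases h : N ≤ n
      · refine (cb n f _ fun t ht => (hξ n t (K.subset h (hN (hf ht)))).le).trans ?_
        simp only [if_pos h]
        refine mul_le_mul_of_nonneg_right ?_ (integral_nonneg fun _ => norm_nonneg _)
        rw [one_div_pow, mul_one_div, div_le_div_iff₀ (by positivity) (by positivity)]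
        have : (0 : ℝ) < 2 ^ n := by positivity
        nlinarith
      · simp only [if_neg h]
        refine cb n f _ fun t _ => (norm_sub_le _ _).trans ?_
        rw [norm_unitary_apply, ξ1]; norm_num)
  have hcoord : ∀ (a : CcTilde0 μ) n, coordL n (M (a : Unitization ℂ (CcG μ)).snd)
      = (n : ℂ) • integratedHom hπ (a : Unitization ℂ (CcG μ)) (ξ n) := by
    intro a n
    rw [hM, hcn, integratedHom_eq, CcTilde0.fst_eq]
    congr 1
    rw [_root_.add_apply, _root_.smul_apply, one_apply_eq_self, neg_smul]
    abel
  let Ξ : CcTilde0 μ →ₗ[ℂ] HilbertSum H :=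
    { toFun := fun a => M (a : Unitization ℂ (CcG μ)).snd
      map_add' := fun a b => M.map_add _ _
      map_smul' := fun z a => M.map_smul z _ }
  refine ⟨σ, hσ, Ξ, cM.comp (continuous_unitization_snd.comp continuous_subtype_val), ?_, ?_⟩
  · intro a b
    ext n
    change coordL n (M ((a * b : CcTilde0 μ) : Unitization ℂ (CcG μ)).snd)
      = coordL n (integratedHom hσ (a : Unitization ℂ (CcG μ))
          (M (b : Unitization ℂ (CcG μ)).snd))
    have h1 : ∀ w, coordL n (integratedHom hσ (a : Unitization ℂ (CcG μ)) w)
        = integratedHom hπ (a : Unitization ℂ (CcG μ)) (coordL n w) := by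
      intro w
      rw [integratedHom_eq, integratedHom_eq]
      simp only [_root_.add_apply, _root_.smul_apply, one_apply_eq_self, map_add, map_smul,
        coordL_intRep hπ hσ hc]
    rw [h1, hcoord, hcoord, map_smul]
    congr 1
    exact DFunLike.congr_fun (map_mul (integratedHom hπ) (a : Unitization ℂ (CcG μ)) b) (ξ n)
  · intro η
    by_contra! hη
    -- If η implemented the map on functions of integral zero, this difference would be annihilated
    -- by them, hence invariant, hence 0. Then ‖η‖ ≥ n for every n.
    have hz : ∀ n : ℕ, (n : ℂ) • ξ n - coordL n η = 0 := by
      refine fun n => hno _ (invariant_of_intRep_eq_zero (μ := μ) hπ fun f hf => ?_)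
      have h1 := congrArg (coordL n) (hη f hf)
      rw [coordL_intRep hπ hσ hc] at h1
      change coordL n (M (CcTilde0.ofCc f : Unitization ℂ (CcG μ)).snd) = _ at h1
      rw [CcTilde0.snd_ofCc, hM, hcn, hf, zero_smul, sub_zero] at h1
      rw [map_sub, map_smul, h1, sub_self]
    obtain ⟨n, hn⟩ := exists_nat_gt ‖η‖
    have h1 := lp.norm_apply_le_norm two_ne_zero η n
    rw [← coordL_apply, ← sub_eq_zero.1 (hz n), norm_smul, ξ1, Complex.norm_natCast, mul_one] at h1
    exact absurd hn (not_lt.2 h1)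

lemma propertyT_of_propertyCHRep [SecondCountableTopology G] (h : PropertyCHRep.{u, v} μ) :
    PropertyT.{u, v} G := by
  intro H _ _ _ π hπ hai
  by_contra! hno
  obtain ⟨σ, hσ, Ξ, cΞ, hm, hout⟩ := exists_outer_module_map μ π hπ hai fun ξ hξ => by
    by_contra h0
    obtain ⟨t, ht⟩ := hno ξ h0
    exact ht (hξ t)
  obtain ⟨η, hη⟩ := h (HilbertSum H) σ Ξ hσ cΞ hm
  obtain ⟨f, hf, hne⟩ := hout η
  refine hne ((hη _).trans ?_)
  rw [← integratedHom_apply hσ, integratedHom_eq, CcTilde0.fst_ofCc, CcTilde0.snd_ofCc, hf]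
  simp

/-- The inclusion of `C_c^0(G)` into the augmentation ideal of the unitalization. -/
def Cc0.incl : Cc0 μ →⋆ₙₐ[ℂ] CcTilde0 μ where
  toFun f := CcTilde0.ofCc f
  map_smul' c f := map_smul CcTilde0.ofCc c (f : CcG μ)
  map_zero' := map_zero CcTilde0.ofCc
  map_add' f g := map_add CcTilde0.ofCc (f : CcG μ) g
  map_mul' f g := by
    have hf : CcG.eps (f : CcG μ) = 0 := f.2
    have hg : CcG.eps (g : CcG μ) = 0 := g.2
    refine (CcTilde0.ofCc_mul (f : CcG μ) g).trans ?_
    rw [hf, hg, zero_smul, zero_smul, add_zero, add_zero]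
  map_star' f := CcTilde0.ofCc_star (f : CcG μ)

lemma Cc0.continuous_incl : Continuous (Cc0.incl (μ := μ)) :=
  CcTilde0.continuous_ofCc.comp continuous_subtype_val

/-- The Guichardet map is restricted along `Cc0.incl`. No vector implements it even there, because
the obstruction is already a function of integral zero. -/
lemma propertyT_of_propertyCH_Cc0 [SecondCountableTopology G]
    (h : PropertyCH.{u, v} (Cc0 μ)) : PropertyT.{u, v} G := by
  intro H _ _ _ π hπ hai
  by_contra! hno
  obtain ⟨σ, hσ, Ξ, cΞ, hm, hout⟩ := exists_outer_module_map μ π hπ hai fun ξ hξ => by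
    by_contra h0
    obtain ⟨t, ht⟩ := hno ξ h0
    exact ht (hξ t)
  obtain ⟨η, hη⟩ := h (HilbertSum H)
    ((CcG.intRepHom hσ).comp (NonUnitalStarSubalgebraClass.subtype (Cc0 μ)))
    (Ξ ∘ₗ (Cc0.incl (μ := μ) : Cc0 μ →ₗ[ℂ] CcTilde0 μ))
    ((CcG.continuous_intRepHom hσ).comp continuous_subtype_val) (cΞ.comp Cc0.continuous_incl)
    (fun f g => by
      change Ξ (Cc0.incl (f * g)) = CcG.intRepHom hσ (f : CcG μ) (Ξ (Cc0.incl g))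
      rw [map_mul, hm, integratedHom_eq]
      change ((CcTilde0.ofCc (f : CcG μ) : Unitization ℂ (CcG μ)).fst
          • (1 : HilbertSum H →L[ℂ] HilbertSum H)
        + CcG.intRepHom hσ (CcTilde0.ofCc (f : CcG μ) : Unitization ℂ (CcG μ)).snd :
          HilbertSum H →L[ℂ] HilbertSum H) _ = _
      rw [CcTilde0.fst_ofCc, CcTilde0.snd_ofCc, (show CcG.eps (f : CcG μ) = 0 from f.2), neg_zero,
        zero_smul, zero_add])
  obtain ⟨f, hf, hne⟩ := hout η
  exact hne (hη ⟨f, hf⟩)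

end Guichardet

end

end GroupAlg

theorem mainTheorem1 {G : Type u} [Group G] [TopologicalSpace G] [IsTopologicalGroup G]
    [LocallyCompactSpace G] [T2Space G] [MeasurableSpace G] [BorelSpace G]
    (μ : MeasureTheory.Measure G) [μ.IsHaarMeasure] [μ.Regular] :
    GroupAlg.PropertyFH.{u, v} (GroupAlg.L1G μ) (GroupAlg.L1G.eps (μ := μ)) ∧
    (SecondCountableTopology G →
      List.TFAE
        [GroupAlg.PropertyT.{u, v} G,
         GroupAlg.PropertyFH.{u, v} (GroupAlg.CcG μ) (GroupAlg.CcG.eps (μ := μ)),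
         GroupAlg.PropertyCH.{u, v} (GroupAlg.CcTilde0 μ),
         GroupAlg.PropertyCHRep.{u, v} μ]) ∧
    (SecondCountableTopology G →
      GroupAlg.PropertyCH.{u, v} (GroupAlg.Cc0 μ) → GroupAlg.PropertyT.{u, v} G) := by
  refine ⟨GroupAlg.L1G.propertyFH μ, fun _ => ?_,
    fun _ h => GroupAlg.propertyT_of_propertyCH_Cc0 h⟩
  tfae_have 1 → 2 := GroupAlg.propertyFH_of_propertyT
  tfae_have 2 → 3 := GroupAlg.propertyCH_of_propertyFH
  tfae_have 3 → 4 := GroupAlg.propertyCHRep_of_propertyCH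
  tfae_have 4 → 1 := GroupAlg.propertyT_of_propertyCHRep
  tfae_finish
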